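/- Let $V$ be the vertex set of a Platonic polyhedron in $\mathbb{R}^3$ centred at the origin, let $\widetilde{\mathcal R}\subset O(3)$ be its full symmetry group (reflections included) and $\mathcal R=\widetilde{\mathcal R}\cap SO(3)$ its rotation group, $N=|\mathcal R|\in\{12,24,60\}$. Let $\Gamma=\{x\in\mathbb{R}^3 : Rx=x \text{ for some } R\in\mathcal R\setminus\{I\}\}$ be the union of the rotation axes and $\mathcal P=\Gamma\cap\mathbb S^2$ the set of poles; the order $\mathfrak o_p$ of $p\in\mathcal P$ is the number of $R\in\mathcal R$ with $Rp=p$. The planes of the reflections in $\widetilde{\mathcal R}$ divide $\mathbb S^2$ into $2N$ open spherical triangles; let $\tau$ be any of them. Let $\alpha\in[1,2)$, $m_0\ge 0$, $T>0$, and let $M\ge 1$ be an integer. For a $T$-periodic $H^1$ loop $u:\mathbb{R}\to\mathbb{R}^3$ (the motion of the generating particle, the $N$ satellites of unit mass being $Ru$, $R\in\mathcal R$, with a central mass $m_0$ fixed at the origin) put $$\mathcal A^\alpha(u)=N\int_0^T\Big(\frac{|\dot u|^2}{2}+\frac{m_0}{|u|^\alpha}+\frac12\sum_{R\in\mathcal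 R\setminus\{I\}}\frac{1}{|(R-I)u|^\alpha}\Big)dt\in[0,+\infty].$$ Fix a non-trivial free-homotopy class of loops in $\mathbb{R}^3\setminus\Gamma$, and let $\mathcal K$ be the set of $T$-periodic $H^1$ loops $u$ with values in $\mathbb{R}^3\setminus\Gamma$ that belong to this class and satisfy $u(t+T/M)=Ru(t)$ for all $t\in\mathbb{R}$, for some $R\in\mathcal R$. Let $\overline{\mathcal K}$ be the closure of $\mathcal K$ in the $H^1$ topology. If $u\in\overline{\mathcal K}$ has (at least) $M$ total collisions per period, that is, $u(t)=0$ for at least $M$ times $t\in[0,T)$, where $M$ is the same integer as in the symmetry condition defining $\mathcal K$, then $$\mathcal A^\alpha(u)\ \ge\ \frac{2+\alpha}{2-\alpha}\,\frac N2\,\big(\tilde U_{\alpha,0}+2m_0\big)^{\frac{2}{2+\alpha}}\Big(\frac{M\pi}{\alpha}\Big)^{\frac{2\alpha}{2+\alpha}}T^{\frac{2-\alpha}{2+\alpha}},$$ where $$\tilde U_{\alpha,0}=\frac1{2^{\alpha+1}}\sum_{p\in\mathcal P}\frac{k_{\alpha,p}}{\max_{x\in\overline\tau}|x\times p|^\alpha},\qquad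 k_{\alpha,p}=\sum_{j=1}^{\mathfrak o_p-1}\frac1{\sin^\alpha(j\pi/\mathfrak o_p)}.$$ -/

import Mathlib

open MeasureTheory Set
open scoped ENNReal

noncomputable section

namespace PlatonicBody

/-- Euclidean three-space. -/
abbrev R3 : Type := EuclideanSpace ℝ (Fin 3)

/-! The Platonic polyhedra centred at the origin, given by their sets of vertices.
Coordinate indices are taken modulo 3, so each condition is cyclically symmetric. -/

/-- The tetrahedron `(1,1,1), (1,-1,-1), (-1,1,-1), (-1,-1,1)`. -/
def tetrahedron : Set R3 := {x | (∀ i, |x i| = 1) ∧ x 0 * x 1 * x 2 = 1}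

/-- The cube `(±1,±1,±1)`. -/
def cube : Set R3 := {x | ∀ i, |x i| = 1}

/-- The octahedron with vertices plus or minus the standard basis vectors. -/
def octahedron : Set R3 := {x | ∃ i : Fin 3, |x i| = 1 ∧ x (i + 1) = 0 ∧ x (i + 2) = 0}

/-- The icosahedron: cyclic permutations of `(0, ±1, ±φ)`, with `φ` the golden ratio. -/
def icosahedron : Set R3 :=
  {x | ∃ i : Fin 3, x i = 0 ∧ |x (i + 1)| = 1 ∧ |x (i + 2)| = Real.goldenRatio}

/-- The dodecahedron: `(±1,±1,±1)` and the cyclic permutations of `(0, ±φ⁻¹, ±φ)`. -/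
def dodecahedron : Set R3 :=
  cube ∪ {x | ∃ i : Fin 3, x i = 0 ∧ |x (i + 1)| = Real.goldenRatio⁻¹ ∧
    |x (i + 2)| = Real.goldenRatio}

/-- `V` is the vertex set of a Platonic polyhedron centred at the origin (any size and position). -/
def IsPlatonic (V : Set R3) : Prop :=
  ∃ P ∈ ({tetrahedron, cube, octahedron, icosahedron, dodecahedron} : Set (Set R3)),
    ∃ r : ℝ, 0 < r ∧ ∃ g : R3 ≃ₗᵢ[ℝ] R3, V = (fun x => r • g x) '' P

/-- The full symmetry group (reflections included) of the polyhedron with vertex set `V`. -/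
def fullGroup (V : Set R3) : Subgroup (R3 ≃ₗᵢ[ℝ] R3) where
  carrier := {g | g '' V = V}
  one_mem' := by simp
  mul_mem' := by
    intro a b ha hb
    simp only [Set.mem_ofPred_eq] at ha hb ⊢
    rw [LinearIsometryEquiv.coe_mul, image_comp, hb, ha]
  inv_mem' := by
    intro a ha
    simp only [Set.mem_ofPred_eq] at ha ⊢
    conv_lhs => rw [← ha]
    rw [← image_comp, ← LinearIsometryEquiv.coe_mul, inv_mul_cancel]
    simp

/-- The rotation group of the polyhedron with vertex set `V`. -/
def rotationGroup (V : Set R3) : Subgroup (R3 ≃ₗᵢ[ℝ] R3) where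
  carrier := {g | g ∈ fullGroup V ∧ LinearMap.det (g.toLinearEquiv : R3 →ₗ[ℝ] R3) = 1}
  one_mem' := ⟨one_mem _, LinearMap.det_id⟩
  mul_mem' := by
    rintro a b ⟨ha, ha'⟩ ⟨hb, hb'⟩
    refine ⟨mul_mem ha hb, ?_⟩
    have h : ((a * b).toLinearEquiv : R3 →ₗ[ℝ] R3)
        = (a.toLinearEquiv : R3 →ₗ[ℝ] R3) ∘ₗ (b.toLinearEquiv : R3 →ₗ[ℝ] R3) := rfl
    rw [h, LinearMap.det_comp, ha', hb', one_mul]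
  inv_mem' := by
    rintro a ⟨ha, ha'⟩
    refine ⟨inv_mem ha, ?_⟩
    have h : ((a⁻¹).toLinearEquiv : R3 →ₗ[ℝ] R3) ∘ₗ (a.toLinearEquiv : R3 →ₗ[ℝ] R3)
        = LinearMap.id := by
      ext1 x
      exact a.symm_apply_apply x
    have h2 := congrArg LinearMap.det h
    rw [LinearMap.det_comp, ha', mul_one, LinearMap.det_id] at h2
    exact h2

/-- The collision set `Γ`: the union of the axes of the non-identity elements of `G`. -/
def collisionSet (G : Subgroup (R3 ≃ₗᵢ[ℝ] R3)) : Set R3 :=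
  {x | ∃ R ∈ G, R ≠ 1 ∧ R x = x}

/-- The poles: the points of the unit sphere on the rotation axes. -/
def poles (G : Subgroup (R3 ≃ₗᵢ[ℝ] R3)) : Set R3 :=
  collisionSet G ∩ Metric.sphere 0 1

/-- The order of a pole: the number of elements of `G` that fix it. -/
def poleOrder (G : Subgroup (R3 ≃ₗᵢ[ℝ] R3)) (p : R3) : ℕ :=
  Nat.card {R : R3 ≃ₗᵢ[ℝ] R3 // R ∈ G ∧ R p = p}

/-- The union of the mirror planes of the plane reflections that belong to `G`. -/
def mirrors (G : Subgroup (R3 ≃ₗᵢ[ℝ] R3)) : Set R3 :=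
  {x | ∃ n : R3, n ≠ 0 ∧ (Submodule.span ℝ {n})ᗮ.reflection ∈ G ∧ inner ℝ n x = 0}

/-- The open triangles of the tessellation of the unit sphere that is cut out by the mirror
planes of `G`. -/
def tessellation (G : Subgroup (R3 ≃ₗᵢ[ℝ] R3)) : Set (Set R3) :=
  {τ | ∃ x ∈ Metric.sphere (0 : R3) 1 \ mirrors G,
    τ = connectedComponentIn (Metric.sphere (0 : R3) 1 \ mirrors G) x}

/-- The Euclidean norm of the cross product of `x` and `p`. -/
def crossNorm (x p : R3) : ℝ :=
  ‖WithLp.toLp 2 (crossProduct (WithLp.ofLp x) (WithLp.ofLp p))‖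

/-- `k_{α,p} = ∑_{j=1}^{o_p-1} 1 / sin^α (jπ/o_p)`. -/
def poleCoeff (G : Subgroup (R3 ≃ₗᵢ[ℝ] R3)) (α : ℝ) (p : R3) : ℝ :=
  ∑ j ∈ Finset.Ico 1 (poleOrder G p), 1 / Real.sin (j * Real.pi / poleOrder G p) ^ α

/-- `Ũ_{α,0} = 2^{-(α+1)} ∑_p k_{α,p} / max_{x ∈ closure τ} |x × p|^α`, the sum being over the
(finitely many) poles. -/
def potentialBound (G : Subgroup (R3 ≃ₗᵢ[ℝ] R3)) (τ : Set R3) (α : ℝ) : ℝ :=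
  1 / 2 ^ (α + 1) *
    ∑ᶠ p : poles G, poleCoeff G α p / sSup ((fun x => crossNorm x p ^ α) '' closure τ)

/-- `T`-periodic loops of class `H¹`: absolutely continuous with derivative in `L²(0,T)`. -/
def IsH1Loop (T : ℝ) (u : ℝ → R3) : Prop :=
  Function.Periodic u T ∧
    ∃ v : ℝ → R3, MemLp v 2 (volume.restrict (Ioc 0 T)) ∧
      ∀ t ∈ Icc 0 T, u t = u 0 + ∫ s in (0 : ℝ)..t, v s

/-- The squared `H¹(0,T)` distance of two loops. -/
def h1DistSq (T : ℝ) (u w : ℝ → R3) : ℝ≥0∞ :=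
  ∫⁻ t in Ioc 0 T, (‖u t - w t‖ₑ ^ 2 + ‖deriv u t - deriv w t‖ₑ ^ 2)

/-- The closure of a set of loops in the space of `T`-periodic `H¹` loops. -/
def h1Closure (T : ℝ) (K : Set (ℝ → R3)) : Set (ℝ → R3) :=
  {u | IsH1Loop T u ∧ ∀ ε > 0, ∃ w ∈ K, h1DistSq T u w < ε}

/-- The set of `H¹` loops that avoid `Γ`, lie in the free-homotopy class of the loop `c` in the
complement of `Γ`, and satisfy `u (t + T / M) = R (u t)` for some `R ∈ G` and all `t`. -/
def cone (G : Subgroup (R3 ≃ₗᵢ[ℝ] R3)) (T : ℝ) (M : ℕ)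
    (c : C(AddCircle T, {x : R3 // x ∉ collisionSet G})) : Set (ℝ → R3) :=
  {u | IsH1Loop T u ∧
    (∃ f : C(AddCircle T, {x : R3 // x ∉ collisionSet G}),
      (∀ t : ℝ, (f (t : AddCircle T) : R3) = u t) ∧ f.Homotopic c) ∧
    ∃ R ∈ G, ∀ t : ℝ, u (t + T / M) = R (u t)}

/-- The action of the symmetric motion generated by `u`,
`N ∫₀ᵀ (|u'|²/2 + m₀/|u|^α + (1/2) ∑_{R ≠ 1} 1/|(R - 1)u|^α) dt` with `N = |G|`, as an extended
nonnegative real. -/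
def action (G : Subgroup (R3 ≃ₗᵢ[ℝ] R3)) (α m₀ T : ℝ) (u : ℝ → R3) : ℝ≥0∞ :=
  Nat.card G * ∫⁻ t in Ioc 0 T,
    (‖deriv u t‖ₑ ^ 2 / 2 + ENNReal.ofReal m₀ / ‖u t‖ₑ ^ α +
      1 / 2 * ∑' R : {R : R3 ≃ₗᵢ[ℝ] R3 // R ∈ G ∧ R ≠ 1}, 1 / ‖R.1 (u t) - u t‖ₑ ^ α)

/-- The times in one period at which all particles collide at the origin. -/
def totalCollisions (T : ℝ) (u : ℝ → R3) : Set ℝ := {t ∈ Ico 0 T | u t = 0}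

end PlatonicBody

end

/-!
Put `μ = m₀ + Ũ / 2`. The Lagrangian of the generating particle is at least
`|u'|² / 2 + μ / |u| ^ α`. A rotation `R ≠ 1` of angle `θ` with axis through the pole `p` moves `x`
by `2 |sin (θ / 2)| |x × p|` and fixes only the two unit vectors `±p`, so the sum over the rotations
is half of a sum over the poles, which brings in the coefficients `k_{α,p}`; and the closure of a
triangle `τ` meets every orbit of the full group on the sphere, so bounding `|x × p|` on `closure τ`
suffices.

All members of the cone satisfy `|u (t + T / M)| = |u t|`. This condition passes to the closure, so
one collision yields `M` of them per period, equally spaced, and it remains to bound the action of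
an arc of duration `S` that starts and ends at the origin. Let `R` be its maximal distance. Radial
motion with energy `μ / R ^ α` calibrates the problem: by Young's inequality,
`|v|² / 2 + μ / |x| ^ α ≥ μ / R ^ α + √(2 * μ) * radialSpeed α R |x| * |v|` whenever `|x| ≤ R`. The
last term integrates to at least twice the primitive of `radialSpeed α R` at `R`, since the arc goes
out to distance `R` and comes back, and weighted AM–GM removes `R` from the resulting bound.
-/

namespace PlatonicBody

open Filter Topology

/-! ### Absolutely continuous paths -/

theorem absolutelyContinuousOnInterval_of_dist_le {X Y : Type*} [PseudoMetricSpace X]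
    [PseudoMetricSpace Y] {f : ℝ → X} {g : ℝ → Y} {a b C : ℝ}
    (hg : AbsolutelyContinuousOnInterval g a b)
    (h : ∀ s t, dist (f s) (f t) ≤ C * dist (g s) (g t)) :
    AbsolutelyContinuousOnInterval f a b := by
  unfold AbsolutelyContinuousOnInterval at hg ⊢
  refine squeeze_zero (fun _ => Finset.sum_nonneg fun _ _ => dist_nonneg) (fun E => ?_)
    (by simpa using hg.const_mul C)
  rw [Finset.mul_sum]
  exact Finset.sum_le_sum fun i _ => h _ _

section Substitution

variable {ψ w : ℝ → ℝ} {a b C : ℝ}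

theorem dist_integral_le_of_norm_le (hψ : Continuous ψ) (hC : ∀ s, ‖ψ s‖ ≤ C) (c x y : ℝ) :
    dist (∫ s in c..x, ψ s) (∫ s in c..y, ψ s) ≤ C * dist x y := by
  rw [Real.dist_eq, Real.dist_eq, intervalIntegral.integral_interval_sub_left
    (hψ.intervalIntegrable _ _) (hψ.intervalIntegrable _ _)]
  exact intervalIntegral.norm_integral_le_of_norm_le_const fun s _ => hC s

theorem integral_comp_mul_deriv_of_absolutelyContinuousOnInterval (hψ : Continuous ψ)
    (hC : ∀ s, ‖ψ s‖ ≤ C) (hw : AbsolutelyContinuousOnInterval w a b) :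
    ∫ t in a..b, ψ (w t) * deriv w t = ∫ s in w a..w b, ψ s := by
  set Ψ : ℝ → ℝ := fun x => ∫ s in (0 : ℝ)..x, ψ s
  have hΨ (x : ℝ) : HasDerivAt Ψ (ψ x) x :=
    intervalIntegral.integral_hasDerivAt_right (hψ.intervalIntegrable _ _)
      (hψ.stronglyMeasurableAtFilter _ _) hψ.continuousAt
  have hac : AbsolutelyContinuousOnInterval (Ψ ∘ w) a b :=
    absolutelyContinuousOnInterval_of_dist_le hw fun s t =>
      dist_integral_le_of_norm_le hψ hC 0 (w s) (w t)
  have hderiv : ∀ᵐ t, t ∈ uIoc a b → ψ (w t) * deriv w t = deriv (Ψ ∘ w) t := by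
    filter_upwards [hw.ae_differentiableAt] with t ht hm
    exact ((hΨ (w t)).comp t (ht (uIoc_subset_uIcc hm)).hasDerivAt).deriv.symm
  rw [intervalIntegral.integral_congr_ae hderiv, hac.integral_deriv_eq_sub]
  exact intervalIntegral.integral_interval_sub_left (hψ.intervalIntegrable _ _)
    (hψ.intervalIntegrable _ _)

end Substitution

section Path

variable {E : Type*} [NormedAddCommGroup E] [NormedSpace ℝ E] {u v : ℝ → E} {a b T : ℝ}

theorem abs_deriv_norm_le {u' : E} {t : ℝ} (hu : HasDerivAt u u' t) :
    |deriv (fun s => ‖u s‖) t| ≤ ‖u'‖ := by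
  by_cases hd : DifferentiableAt ℝ (fun s => ‖u s‖) t
  · refine le_of_tendsto_of_tendsto (hasDerivAt_iff_tendsto_slope.1 hd.hasDerivAt).abs
      (hasDerivAt_iff_tendsto_slope.1 hu).norm (Eventually.of_forall fun s => ?_)
    simp only [slope_def_module, norm_smul, smul_eq_mul, abs_mul, Real.norm_eq_abs]
    gcongr
    exact abs_norm_sub_norm_le _ _
  · rw [deriv_zero_of_not_differentiableAt hd, abs_zero]
    exact norm_nonneg _

/-- A path that is the integral of its derivative. Requiring integrability of `deriv u` on every
interval rules out the value `0` that the integral of a non-integrable function takes. -/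
structure IsACPath (u : ℝ → E) : Prop where
  intervalIntegrable : ∀ a b, IntervalIntegrable (deriv u) volume a b
  integral_deriv : ∀ a b, ∫ t in a..b, deriv u t = u b - u a

namespace IsACPath

theorem norm_sub_le (hu : IsACPath u) (s t : ℝ) : ‖u t - u s‖ ≤ |∫ r in s..t, ‖deriv u r‖| := by
  rw [← hu.integral_deriv s t]
  exact intervalIntegral.norm_integral_le_abs_integral_norm

theorem continuous (hu : IsACPath u) : Continuous u := by
  have h : u = fun t => (∫ s in (0 : ℝ)..t, deriv u s) + u 0 := by
    ext t
    rw [hu.integral_deriv, sub_add_cancel]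
  rw [h]
  exact (intervalIntegral.continuous_primitive hu.intervalIntegrable 0).add continuous_const

theorem absolutelyContinuousOnInterval_norm (hu : IsACPath u) (a b : ℝ) :
    AbsolutelyContinuousOnInterval (fun t => ‖u t‖) a b := by
  have hn (x y : ℝ) : IntervalIntegrable (fun t => ‖deriv u t‖) volume x y :=
    (hu.intervalIntegrable x y).norm
  refine absolutelyContinuousOnInterval_of_dist_le (C := 1)
    ((hn a b).absolutelyContinuousOnInterval_intervalIntegral left_mem_uIcc) fun s t => ?_
  rw [dist_comm, dist_comm (∫ t in a..s, ‖deriv u t‖), Real.dist_eq, Real.dist_eq, one_mul,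
    intervalIntegral.integral_interval_sub_left (hn _ _) (hn _ _)]
  exact (abs_norm_sub_norm_le _ _).trans (hu.norm_sub_le s t)

theorem intervalIntegrable_comp_norm_mul (hu : IsACPath u) {ψ : ℝ → ℝ} (hψ : Continuous ψ)
    (a b : ℝ) : IntervalIntegrable (fun t => ψ ‖u t‖ * ‖deriv u t‖) volume a b :=
  (hu.intervalIntegrable a b).norm.continuousOn_mul (hψ.comp hu.continuous.norm).continuousOn

variable [CompleteSpace E]

theorem ae_hasDerivAt (hu : IsACPath u) : ∀ᵐ t, HasDerivAt u (deriv u t) t := by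
  have hl : LocallyIntegrable (deriv u) volume := fun x =>
    ⟨Ioc (x - 1) (x + 1), Ioc_mem_nhds (by linarith) (by linarith),
      (hu.intervalIntegrable (x - 1) (x + 1)).1⟩
  filter_upwards [_root_.LocallyIntegrable.ae_hasDerivAt_integral hl] with t ht
  refine ((ht 0).add_const (u 0)).congr_of_eventuallyEq (Eventually.of_forall fun s => ?_)
  simp only [hu.integral_deriv, sub_add_cancel]

theorem abs_integral_comp_norm_le (hu : IsACPath u) {ψ : ℝ → ℝ} (hψ : Continuous ψ)
    (hψ0 : ∀ s, 0 ≤ ψ s) {C : ℝ} (hC : ∀ s, ψ s ≤ C) (hab : a ≤ b) :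
    |∫ s in ‖u a‖..‖u b‖, ψ s| ≤ ∫ t in a..b, ψ ‖u t‖ * ‖deriv u t‖ := by
  have hC' (s : ℝ) : ‖ψ s‖ ≤ C := (Real.norm_of_nonneg (hψ0 s)).trans_le (hC s)
  rw [← integral_comp_mul_deriv_of_absolutelyContinuousOnInterval hψ hC'
    (hu.absolutelyContinuousOnInterval_norm a b), ← Real.norm_eq_abs]
  refine intervalIntegral.norm_integral_le_of_norm_le hab ?_
    (hu.intervalIntegrable_comp_norm_mul hψ a b)
  filter_upwards [hu.ae_hasDerivAt] with t ht _
  rw [norm_mul, Real.norm_of_nonneg (hψ0 _)]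
  exact mul_le_mul_of_nonneg_left (abs_deriv_norm_le ht) (hψ0 _)

theorem two_mul_integral_le (hu : IsACPath u) {ψ : ℝ → ℝ} (hψ : Continuous ψ)
    (hψ0 : ∀ s, 0 ≤ ψ s) {C : ℝ} (hC : ∀ s, ψ s ≤ C) (ha : u a = 0) (hb : u b = 0) {m : ℝ}
    (hm : m ∈ Icc a b) :
    2 * ∫ s in (0 : ℝ)..‖u m‖, ψ s ≤ ∫ t in a..b, ψ ‖u t‖ * ‖deriv u t‖ := by
  have hout := (le_abs_self _).trans (hu.abs_integral_comp_norm_le hψ hψ0 hC hm.1)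
  have hin := (neg_le_abs _).trans (hu.abs_integral_comp_norm_le hψ hψ0 hC hm.2)
  rw [ha, norm_zero] at hout
  rw [← intervalIntegral.integral_symm, hb, norm_zero] at hin
  rw [← intervalIntegral.integral_add_adjacent_intervals
    (hu.intervalIntegrable_comp_norm_mul hψ a m) (hu.intervalIntegrable_comp_norm_mul hψ m b)]
  linarith

end IsACPath

/-! ### Periodic loops of class `H¹` -/

theorem ae_deriv_eq_of_eq_add_integral [CompleteSpace E] {c : E}
    (hv : IntervalIntegrable v volume a b) (hab : a ≤ b)
    (huv : ∀ t ∈ Icc a b, u t = c + ∫ s in a..t, v s) :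
    ∀ᵐ t, t ∈ Ioc a b → deriv u t = v t := by
  filter_upwards [hv.ae_hasDerivAt_integral, compl_mem_ae_iff.2 (measure_singleton b)]
    with t ht hne hm
  have htb : t < b := hm.2.lt_of_ne hne
  have ht' := (ht (uIcc_of_le hab ▸ Ioc_subset_Icc_self hm) a left_mem_uIcc).const_add c
  refine (ht'.congr_of_eventuallyEq ?_).deriv
  filter_upwards [Ioo_mem_nhds hm.1 htb] with s hs using huv s (Ioo_subset_Icc_self hs)

theorem periodic_deriv (hu : Function.Periodic u T) : Function.Periodic (deriv u) T := by
  intro t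
  rw [← deriv_comp_add_const, show (fun s => u (s + T)) = u from funext hu]

theorem integral_deriv_of_periodic (hT : 0 < T) (hu : Function.Periodic u T)
    (hint : ∀ a b, IntervalIntegrable (deriv u) volume a b)
    (hftc : ∀ t ∈ Icc 0 T, ∫ s in (0 : ℝ)..t, deriv u s = u t - u 0) (t : ℝ) :
    ∫ s in (0 : ℝ)..t, deriv u s = u t - u 0 := by
  have hper : Function.Periodic (fun t => (∫ s in (0 : ℝ)..t, deriv u s) - (u t - u 0)) T := by
    intro t
    have hadd := intervalIntegral.integral_add_adjacent_intervals (hint 0 t) (hint t (t + T))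
    have hmean : ∫ s in t..t + T, deriv u s = 0 := by
      rw [(periodic_deriv hu).intervalIntegral_add_eq t 0, zero_add, hftc T ⟨hT.le, le_rfl⟩,
        ← zero_add T, hu 0, sub_self]
    simp only [← hadd, hmean, add_zero, hu t]
  obtain ⟨s, hs, hst⟩ := hper.exists_mem_Ico₀ hT t
  simp only [hftc s (Ico_subset_Icc_self hs), sub_self] at hst
  exact sub_eq_zero.1 hst

theorem isACPath_of_periodic [CompleteSpace E] {c : E} (hT : 0 < T) (hu : Function.Periodic u T)
    (hv : IntervalIntegrable v volume 0 T)
    (huv : ∀ t ∈ Icc 0 T, u t = c + ∫ s in (0 : ℝ)..t, v s) : IsACPath u := by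
  have hderiv : ∀ᵐ t, t ∈ Ioc 0 T → deriv u t = v t :=
    ae_deriv_eq_of_eq_add_integral hv hT.le huv
  have hint : ∀ a b, IntervalIntegrable (deriv u) volume a b := by
    refine (periodic_deriv hu).intervalIntegrable₀ hT.ne' (hv.congr_ae ?_)
    rw [uIoc_of_le hT.le]
    refine (ae_restrict_iff' measurableSet_Ioc).2 ?_
    filter_upwards [hderiv] with t ht hm using (ht hm).symm
  have hftc : ∀ t ∈ Icc 0 T, ∫ s in (0 : ℝ)..t, deriv u s = u t - u 0 := by
    intro t ht
    rw [huv t ht, huv 0 ⟨le_rfl, hT.le⟩, intervalIntegral.integral_same, add_zero,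
      add_sub_cancel_left]
    refine intervalIntegral.integral_congr_ae ?_
    rw [uIoc_of_le ht.1]
    filter_upwards [hderiv] with s hs hm using hs ⟨hm.1, hm.2.trans ht.2⟩
  refine ⟨hint, fun a b => ?_⟩
  rw [← intervalIntegral.integral_interval_sub_left (hint 0 b) (hint 0 a),
    integral_deriv_of_periodic hT hu hint hftc, integral_deriv_of_periodic hT hu hint hftc,
    sub_sub_sub_cancel_right]

end Path

theorem IsH1Loop.isACPath {T : ℝ} {u : ℝ → R3} (hT : 0 < T) (hu : IsH1Loop T u) : IsACPath u := by
  obtain ⟨hper, v, hv, huv⟩ := hu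
  refine isACPath_of_periodic hT hper ?_ huv
  rw [intervalIntegrable_iff_integrableOn_Ioc_of_le hT.le]
  exact hv.integrable one_le_two

/-! ### The action of collision-ejection paths -/

/-- The minimal action of a collision-ejection path of duration `S` for the potential
`μ / ρ ^ α`, for `α = 1`; a lower bound for `1 ≤ α < 2`. -/
noncomputable def ejectionAction (α μ S : ℝ) : ℝ :=
  (2 + α) / (2 - α) * (1 / 2) * (2 * μ) ^ (2 / (2 + α)) * (Real.pi / α) ^ (2 * α / (2 + α))
    * S ^ ((2 - α) / (2 + α))

/-- The speed, up to the factor `√(2 * μ)`, at distance `s` from the collision in a radial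
collision-ejection motion with maximal distance `R`: exact for `α = 1`, where it is
`√(1 / s - 1 / R)`, and a lower bound for `1 ≤ α < 2` that has an explicit primitive. -/
noncomputable def radialSpeed (α R s : ℝ) : ℝ := s ^ (-(α / 2)) * √(1 - (s / R) ^ (2 - α))

/-- The primitive of `radialSpeed α R` on `(0, ∞)` that tends to `0` at `0`, obtained from the
substitution `y = (s / R) ^ (1 - α / 2)`. -/
noncomputable def radialPrimitive (α R s : ℝ) : ℝ :=
  R ^ (1 - α / 2) * (2 / (2 - α)) * ∫ y in (0 : ℝ)..(s / R) ^ (1 - α / 2), √(1 - y ^ 2)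

theorem hasDerivAt_integral_sqrt_one_sub_sq (z : ℝ) :
    HasDerivAt (fun z => ∫ y in (0 : ℝ)..z, √(1 - y ^ 2)) (√(1 - z ^ 2)) z := by
  have hc : Continuous fun y : ℝ => √(1 - y ^ 2) := by fun_prop
  exact intervalIntegral.integral_hasDerivAt_right (hc.intervalIntegrable _ _)
    (hc.stronglyMeasurableAtFilter _ _) hc.continuousAt

theorem integral_sqrt_one_sub_sq_zero_one : ∫ y in (0 : ℝ)..1, √(1 - y ^ 2) = Real.pi / 4 := by
  have hc : Continuous fun y : ℝ => √(1 - y ^ 2) := by fun_prop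
  have hadd := intervalIntegral.integral_add_adjacent_intervals
    (hc.intervalIntegrable (-1) 0) (hc.intervalIntegrable (μ := volume) 0 1)
  have heven : ∫ y in (-1 : ℝ)..0, √(1 - y ^ 2) = ∫ y in (0 : ℝ)..1, √(1 - y ^ 2) := by
    have hneg := intervalIntegral.integral_comp_neg (a := 0) (b := 1) fun y : ℝ => √(1 - y ^ 2)
    simpa using hneg.symm
  rw [integral_sqrt_one_sub_sq, heven] at hadd
  linarith

section Radial

variable {α μ R S δ s : ℝ}

theorem radialPrimitive_zero (hα : α < 2) : radialPrimitive α R 0 = 0 := by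
  rw [radialPrimitive, zero_div, Real.zero_rpow (by linarith), intervalIntegral.integral_same,
    mul_zero]

theorem radialPrimitive_self (hR : R ≠ 0) :
    radialPrimitive α R R = R ^ (1 - α / 2) * (2 / (2 - α)) * (Real.pi / 4) := by
  rw [radialPrimitive, div_self hR, Real.one_rpow, integral_sqrt_one_sub_sq_zero_one]

theorem continuous_radialPrimitive (hα : α < 2) : Continuous (radialPrimitive α R) := by
  have houter : Continuous fun z => ∫ y in (0 : ℝ)..z, √(1 - y ^ 2) :=
    continuous_iff_continuousAt.2 fun z => (hasDerivAt_integral_sqrt_one_sub_sq z).continuousAt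
  have hinner : Continuous fun s : ℝ => (s / R) ^ (1 - α / 2) :=
    (continuous_id.div_const R).rpow_const fun _ => Or.inr (by linarith)
  exact continuous_const.mul (houter.comp hinner)

theorem rpow_sq_eq (hs : 0 ≤ s) (p : ℝ) : (s ^ p) ^ 2 = s ^ (2 * p) := by
  rw [← Real.rpow_natCast, ← Real.rpow_mul hs, Nat.cast_ofNat, mul_comm]

theorem hasDerivAt_radialPrimitive (hα : α < 2) (hR : 0 < R) (hs : 0 < s) :
    HasDerivAt (radialPrimitive α R) (radialSpeed α R s) s := by
  have hsR : 0 < s / R := by positivity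
  have hsub : HasDerivAt (fun s : ℝ => (s / R) ^ (1 - α / 2))
      (1 / R * (1 - α / 2) * (s / R) ^ (1 - α / 2 - 1)) s :=
    ((hasDerivAt_id s).div_const R).rpow_const (Or.inl hsR.ne')
  refine (((hasDerivAt_integral_sqrt_one_sub_sq _).comp s hsub).const_mul
    (R ^ (1 - α / 2) * (2 / (2 - α)))).congr_deriv ?_
  have hscale : R ^ (1 - α / 2) * (s / R) ^ (1 - α / 2 - 1) = R * s ^ (-(α / 2)) := by
    rw [Real.div_rpow hs.le hR.le, show 1 - α / 2 - 1 = -(α / 2) by ring,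
      show 1 - α / 2 = 1 + -(α / 2) by ring, Real.rpow_add hR, Real.rpow_one]
    have := Real.rpow_pos_of_pos hR (-(α / 2))
    field_simp
  have hα' : 2 - α ≠ 0 := by linarith
  rw [rpow_sq_eq hsR.le, show 2 * (1 - α / 2) = 2 - α by ring, radialSpeed]
  calc R ^ (1 - α / 2) * (2 / (2 - α)) *
        (√(1 - (s / R) ^ (2 - α)) * (1 / R * (1 - α / 2) * (s / R) ^ (1 - α / 2 - 1)))
      = R ^ (1 - α / 2) * (s / R) ^ (1 - α / 2 - 1) / R * √(1 - (s / R) ^ (2 - α)) *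
          (2 / (2 - α) * (1 - α / 2)) := by ring
    _ = s ^ (-(α / 2)) * √(1 - (s / R) ^ (2 - α)) := by
      rw [hscale]
      field_simp

theorem radialSpeed_nonneg (hs : 0 ≤ s) : 0 ≤ radialSpeed α R s :=
  mul_nonneg (Real.rpow_nonneg hs _) (Real.sqrt_nonneg _)

theorem radialSpeed_le (hα : 0 ≤ α) (hR : 0 ≤ R) (hδ : 0 < δ) (hs : δ ≤ s) :
    radialSpeed α R s ≤ δ ^ (-(α / 2)) := by
  have hs0 : 0 ≤ s := hδ.le.trans hs
  have hsqrt : √(1 - (s / R) ^ (2 - α)) ≤ 1 :=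
    Real.sqrt_le_one.2 (sub_le_self _ (by positivity))
  exact (mul_le_of_le_one_right (Real.rpow_nonneg hs0 _) hsqrt).trans
    (Real.rpow_le_rpow_of_nonpos hδ hs (by linarith))

theorem continuous_radialSpeed_max (hα : α < 2) (hδ : 0 < δ) :
    Continuous fun s => radialSpeed α R (max s δ) := by
  have hmax : Continuous fun s : ℝ => max s δ := continuous_id.max continuous_const
  refine (hmax.rpow_const fun s => Or.inl (lt_max_of_lt_right hδ).ne').mul (Continuous.sqrt ?_)
  exact continuous_const.sub ((hmax.div_const R).rpow_const fun s => Or.inr (by linarith))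

theorem radialSpeed_sq_le (hα : 1 ≤ α) (hs : 0 < s) (hsR : s ≤ R) :
    radialSpeed α R s ^ 2 ≤ s ^ (-α) - R ^ (-α) := by
  have hR : 0 < R := hs.trans_le hsR
  have hq : s / R ≤ 1 := (div_le_one hR).2 hsR
  have hpow : (s / R) ^ α ≤ 1 := Real.rpow_le_one (by positivity) hq (by linarith)
  have hexp : (s / R) ^ α ≤ (s / R) ^ (2 - α) :=
    Real.rpow_le_rpow_of_exponent_ge (by positivity) hq (by linarith)
  have hsqrt : √(1 - (s / R) ^ (2 - α)) ^ 2 ≤ 1 - (s / R) ^ α := by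
    rw [Real.sq_sqrt']
    exact max_le (by linarith) (by linarith)
  calc radialSpeed α R s ^ 2 = s ^ (-α) * √(1 - (s / R) ^ (2 - α)) ^ 2 := by
        rw [radialSpeed, mul_pow, rpow_sq_eq hs.le, mul_neg, mul_div_cancel₀ _ two_ne_zero]
    _ ≤ s ^ (-α) * (1 - (s / R) ^ α) := mul_le_mul_of_nonneg_left hsqrt (Real.rpow_nonneg hs.le _)
    _ = s ^ (-α) - R ^ (-α) := by
        rw [Real.div_rpow hs.le hR.le, Real.rpow_neg hs.le, Real.rpow_neg hR.le]
        have := Real.rpow_pos_of_pos hs α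
        field_simp

theorem radialPrimitive_sub_le_integral (hα : α < 2) (hδ : 0 < δ) (hδR : δ ≤ R) :
    radialPrimitive α R R - radialPrimitive α R δ ≤
      ∫ s in (0 : ℝ)..R, radialSpeed α R (max s δ) := by
  have hint (x y : ℝ) : IntervalIntegrable (fun s => radialSpeed α R (max s δ)) volume x y :=
    (continuous_radialSpeed_max hα hδ).intervalIntegrable x y
  have hftc : ∫ s in δ..R, radialSpeed α R (max s δ) =
      radialPrimitive α R R - radialPrimitive α R δ := by
    refine intervalIntegral.integral_eq_sub_of_hasDerivAt (fun s hs => ?_) (hint _ _)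
    rw [uIcc_of_le hδR] at hs
    rw [max_eq_left hs.1]
    exact hasDerivAt_radialPrimitive hα (hδ.trans_le hδR) (hδ.trans_le hs.1)
  rw [← hftc, ← intervalIntegral.integral_add_adjacent_intervals (hint 0 δ) (hint δ R)]
  exact le_add_of_nonneg_left <| intervalIntegral.integral_nonneg hδ.le fun s hs =>
    radialSpeed_nonneg (le_max_of_le_left hs.1)

theorem ejectionAction_eq_geom_mean (hα : 0 < α) (hα2 : α < 2) (hμ : 0 ≤ μ) (hS : 0 ≤ S)
    (hR : 0 < R) :
    ejectionAction α μ S =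
      ((2 + α) / (2 - α) * (1 / 2) * (2 * μ * R ^ (-α) * S)) ^ ((2 - α) / (2 + α)) *
      ((2 + α) / (2 - α) * (1 / 2) * (√(2 * μ) * R ^ (1 - α / 2) * (Real.pi / α))) ^
        (2 * α / (2 + α)) := by
  have := sub_pos.2 hα2
  set c : ℝ := (2 + α) / (2 - α) * (1 / 2) with hcdef
  set p : ℝ := (2 - α) / (2 + α) with hp
  set q : ℝ := 2 * α / (2 + α) with hq
  have hc : 0 < c := by positivity
  have hp0 : 0 ≤ p := by positivity
  have hq0 : 0 ≤ q := by positivity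
  clear_value c p q
  have hpq : p + q = 1 := by rw [hp, hq]; field_simp; ring
  have hc' : c ^ p * c ^ q = c := by rw [← Real.rpow_add hc, hpq, Real.rpow_one]
  have hμ' : (2 * μ) ^ p * √(2 * μ) ^ q = (2 * μ) ^ (2 / (2 + α)) := by
    rw [Real.sqrt_eq_rpow, ← Real.rpow_mul (by positivity), ← Real.rpow_add_of_nonneg
      (by positivity) hp0 (by positivity)]
    congr 1
    rw [hp, hq]; field_simp; ring
  have hR' : (R ^ (-α)) ^ p * (R ^ (1 - α / 2)) ^ q = 1 := by
    have hexp : -α * p + (1 - α / 2) * q = 0 := by rw [hp, hq]; field_simp; ring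
    rw [← Real.rpow_mul hR.le, ← Real.rpow_mul hR.le, ← Real.rpow_add hR, hexp, Real.rpow_zero]
  calc ejectionAction α μ S
      = (c ^ p * c ^ q) * ((2 * μ) ^ p * √(2 * μ) ^ q) *
          ((R ^ (-α)) ^ p * (R ^ (1 - α / 2)) ^ q) * (Real.pi / α) ^ q * S ^ p := by
        rw [hc', hμ', hR', mul_one, ejectionAction, hcdef, hp, hq]
    _ = (c * (2 * μ * R ^ (-α) * S)) ^ p *
          (c * (√(2 * μ) * R ^ (1 - α / 2) * (Real.pi / α))) ^ q := by
        rw [Real.mul_rpow hc.le (by positivity),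
          Real.mul_rpow (x := 2 * μ * R ^ (-α)) (by positivity) hS,
          Real.mul_rpow (x := 2 * μ) (by positivity) (by positivity),
          Real.mul_rpow hc.le (by positivity),
          Real.mul_rpow (x := √(2 * μ) * R ^ (1 - α / 2)) (by positivity) (by positivity),
          Real.mul_rpow (x := √(2 * μ)) (by positivity) (by positivity)]
        ring

theorem ejectionAction_le (hα : 0 < α) (hα2 : α < 2) (hμ : 0 ≤ μ) (hS : 0 ≤ S) (hR : 0 < R) :
    ejectionAction α μ S ≤ μ * R ^ (-α) * S + √(2 * μ) * (2 * radialPrimitive α R R) := by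
  have h2 : 0 < 2 - α := sub_pos.2 hα2
  rw [ejectionAction_eq_geom_mean hα hα2 hμ hS hR, radialPrimitive_self hR.ne']
  refine (Real.geom_mean_le_arith_mean2_weighted (by positivity) (by positivity) (by positivity)
    (by positivity) (by field_simp; ring)).trans_eq ?_
  field_simp
  ring

theorem energy_add_radialSpeed_mul_le (hα : 1 ≤ α) (hμ : 0 ≤ μ) (hδR : δ ≤ R)
    (hs : 0 < s) (hsR : s ≤ R) (v : ℝ) :
    μ * R ^ (-α) + √(2 * μ) * (radialSpeed α R (max s δ) * v) ≤ v ^ 2 / 2 + μ * s ^ (-α) := by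
  have hspeed : μ * radialSpeed α R (max s δ) ^ 2 ≤ μ * (s ^ (-α) - R ^ (-α)) := by
    refine mul_le_mul_of_nonneg_left ?_ hμ
    exact (radialSpeed_sq_le hα (lt_max_of_lt_left hs) (max_le hsR hδR)).trans <|
      sub_le_sub_right (Real.rpow_le_rpow_of_nonpos hs (le_max_left _ _) (by linarith)) _
  have hyoung := two_mul_le_add_sq v (√(2 * μ) * radialSpeed α R (max s δ))
  rw [mul_pow, Real.sq_sqrt (by positivity)] at hyoung
  linarith

end Radial

section CollisionEjection

variable {E : Type*} [NormedAddCommGroup E] {α μ R δ : ℝ}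

theorem ofReal_lagrangian {x : E} (hx : x ≠ 0) (hμ : 0 ≤ μ) (v : E) :
    ENNReal.ofReal (‖v‖ ^ 2 / 2 + μ * ‖x‖ ^ (-α)) =
      ‖v‖ₑ ^ 2 / 2 + ENNReal.ofReal μ / ‖x‖ₑ ^ α := by
  have hx' : 0 < ‖x‖ := norm_pos_iff.2 hx
  rw [ENNReal.ofReal_add (by positivity) (by positivity), Real.rpow_neg hx'.le, ← div_eq_mul_inv,
    ENNReal.ofReal_div_of_pos (by positivity), ENNReal.ofReal_div_of_pos (by positivity),
    ENNReal.ofReal_pow (norm_nonneg _), ofReal_norm, ← ENNReal.ofReal_rpow_of_pos hx',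
    ofReal_norm, ENNReal.ofReal_ofNat]

theorem div_enorm_zero_rpow (hα : 0 < α) (hμ : 0 < μ) :
    ENNReal.ofReal μ / ‖(0 : E)‖ₑ ^ α = ⊤ := by
  rw [enorm_zero, ENNReal.zero_rpow_of_pos hα, ENNReal.div_zero (ENNReal.ofReal_pos.2 hμ).ne']

theorem ofReal_energy_add_radialSpeed_mul_le (hα : 1 ≤ α) (hμ : 0 < μ) (hδR : δ ≤ R) {x : E}
    (hx : ‖x‖ ≤ R) (v : E) :
    ENNReal.ofReal (μ * R ^ (-α) + √(2 * μ) * (radialSpeed α R (max ‖x‖ δ) * ‖v‖)) ≤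
      ‖v‖ₑ ^ 2 / 2 + ENNReal.ofReal μ / ‖x‖ₑ ^ α := by
  rcases eq_or_ne x 0 with rfl | h0
  · simp only [div_enorm_zero_rpow (one_pos.trans_le hα) hμ, add_top, le_top]
  · rw [← ofReal_lagrangian h0 hμ.le]
    exact ENNReal.ofReal_le_ofReal <|
      energy_add_radialSpeed_mul_le hα hμ.le hδR (norm_pos_iff.2 h0) hx _

variable [NormedSpace ℝ E] [CompleteSpace E] {u : ℝ → E} {a b m : ℝ}

namespace IsACPath

theorem ofReal_energy_add_radialPrimitive_le (hu : IsACPath u) (hα : 1 ≤ α) (hα2 : α < 2)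
    (hμ : 0 < μ) (ha : u a = 0) (hb : u b = 0) (hm : m ∈ Icc a b)
    (hmax : ∀ t ∈ Ioc a b, ‖u t‖ ≤ ‖u m‖) (hδ : 0 < δ) (hδm : δ ≤ ‖u m‖) :
    ENNReal.ofReal (μ * ‖u m‖ ^ (-α) * (b - a) + √(2 * μ) *
        (2 * (radialPrimitive α ‖u m‖ ‖u m‖ - radialPrimitive α ‖u m‖ δ))) ≤
      ∫⁻ t in Ioc a b, (‖deriv u t‖ₑ ^ 2 / 2 + ENNReal.ofReal μ / ‖u t‖ₑ ^ α) := by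
  set R : ℝ := ‖u m‖
  set ψ : ℝ → ℝ := fun s => radialSpeed α R (max s δ)
  have hab : a ≤ b := hm.1.trans hm.2
  have hψ : Continuous ψ := continuous_radialSpeed_max hα2 hδ
  have hψ0 (s : ℝ) : 0 ≤ ψ s := radialSpeed_nonneg (le_max_of_le_right hδ.le)
  have hψC (s : ℝ) : ψ s ≤ δ ^ (-(α / 2)) :=
    radialSpeed_le (by linarith) (norm_nonneg _) hδ (le_max_right _ _)
  have hint := (hu.intervalIntegrable_comp_norm_mul hψ a b).const_mul (√(2 * μ))
  have hpath : 2 * (radialPrimitive α R R - radialPrimitive α R δ) ≤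
      ∫ t in a..b, ψ ‖u t‖ * ‖deriv u t‖ :=
    (mul_le_mul_of_nonneg_left (radialPrimitive_sub_le_integral hα2 hδ hδm) two_pos.le).trans
      (hu.two_mul_integral_le hψ hψ0 hψC ha hb hm)
  calc ENNReal.ofReal (μ * R ^ (-α) * (b - a) +
        √(2 * μ) * (2 * (radialPrimitive α R R - radialPrimitive α R δ)))
      ≤ ENNReal.ofReal (∫ t in a..b, (μ * R ^ (-α) + √(2 * μ) * (ψ ‖u t‖ * ‖deriv u t‖))) := by
        refine ENNReal.ofReal_le_ofReal ?_
        rw [intervalIntegral.integral_add intervalIntegrable_const hint,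
          intervalIntegral.integral_const_mul √(2 * μ), intervalIntegral.integral_const,
          smul_eq_mul, mul_comm (b - a)]
        gcongr
    _ = ∫⁻ t in Ioc a b, ENNReal.ofReal
          (μ * R ^ (-α) + √(2 * μ) * (ψ ‖u t‖ * ‖deriv u t‖)) := by
        rw [intervalIntegral.integral_of_le hab]
        refine ofReal_integral_eq_lintegral_ofReal (intervalIntegrable_const.add hint).1
          (Eventually.of_forall fun t => ?_)
        have := hψ0 ‖u t‖
        simp only [Pi.zero_apply]
        positivity
    _ ≤ _ := setLIntegral_mono' measurableSet_Ioc fun t ht =>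
        ofReal_energy_add_radialSpeed_mul_le hα hμ hδm (hmax t ht) _

theorem ejectionAction_le_lintegral (hu : IsACPath u) (hα : 1 ≤ α) (hα2 : α < 2) (hμ : 0 < μ)
    (hab : a < b) (ha : u a = 0) (hb : u b = 0) :
    ENNReal.ofReal (ejectionAction α μ (b - a)) ≤
      ∫⁻ t in Ioc a b, (‖deriv u t‖ₑ ^ 2 / 2 + ENNReal.ofReal μ / ‖u t‖ₑ ^ α) := by
  have hα0 : 0 < α := one_pos.trans_le hα
  obtain ⟨m, hm, hmax⟩ := isCompact_Icc.exists_isMaxOn (nonempty_Icc.2 hab.le)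
    hu.continuous.norm.continuousOn
  replace hmax : ∀ t ∈ Ioc a b, ‖u t‖ ≤ ‖u m‖ := fun t ht => hmax (Ioc_subset_Icc_self ht)
  rcases (norm_nonneg (u m)).eq_or_lt with h0 | hR
  · have htop : ∀ t ∈ Ioc a b,
        ‖deriv u t‖ₑ ^ 2 / 2 + ENNReal.ofReal μ / ‖u t‖ₑ ^ α = ⊤ := fun t ht => by
      rw [norm_le_zero_iff.1 ((hmax t ht).trans_eq h0.symm), div_enorm_zero_rpow hα0 hμ, add_top]
    rw [setLIntegral_congr_fun measurableSet_Ioc htop, setLIntegral_const, Real.volume_Ioc,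
      ENNReal.top_mul (ENNReal.ofReal_pos.2 (sub_pos.2 hab)).ne']
    exact le_top
  · have hlim : Tendsto (radialPrimitive α ‖u m‖) (𝓝[>] 0) (𝓝 0) := by
      have := ((continuous_radialPrimitive (R := ‖u m‖) hα2).tendsto 0).mono_left
        (nhdsWithin_le_nhds (s := Ioi 0))
      rwa [radialPrimitive_zero hα2] at this
    have hlim' := ENNReal.tendsto_ofReal <| (((hlim.const_sub (radialPrimitive α ‖u m‖ ‖u m‖)
      ).const_mul 2).const_mul √(2 * μ)).const_add (μ * ‖u m‖ ^ (-α) * (b - a))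
    rw [sub_zero] at hlim'
    refine (ENNReal.ofReal_le_ofReal
      (ejectionAction_le hα0 hα2 hμ.le (sub_pos.2 hab).le hR)).trans (le_of_tendsto hlim' ?_)
    filter_upwards [Ioo_mem_nhdsGT hR] with δ hδ using
      hu.ofReal_energy_add_radialPrimitive_le hα hα2 hμ ha hb hm hmax hδ.1 hδ.2.le

end IsACPath

end CollisionEjection

/-! ### Rotations about an axis -/

section Rotation

variable {E : Type*} [NormedAddCommGroup E] [InnerProductSpace ℝ E]
  {b : OrthonormalBasis (Fin 3) ℝ E} {R S : E ≃ₗᵢ[ℝ] E}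

theorem inner_basis_two_apply (hR : R (b 2) = b 2) (x : E) :
    inner ℝ (b 2) (R x) = inner ℝ (b 2) x := by
  conv_lhs => rw [← hR, R.inner_map_map]

theorem norm_sq_eq_sum_inner_sq (b : OrthonormalBasis (Fin 3) ℝ E) (x : E) :
    ‖x‖ ^ 2 = inner ℝ (b 0) x ^ 2 + inner ℝ (b 1) x ^ 2 + inner ℝ (b 2) x ^ 2 := by
  rw [← b.sum_sq_inner_right, Fin.sum_univ_three]

theorem eq_sum_inner_smul (b : OrthonormalBasis (Fin 3) ℝ E) (x : E) :
    x = inner ℝ (b 0) x • b 0 + inner ℝ (b 1) x • b 1 + inner ℝ (b 2) x • b 2 := by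
  rw [← Fin.sum_univ_three fun i => inner ℝ (b i) x • b i, b.sum_repr']

theorem det_eq_of_apply_basis_two (hR : R (b 2) = b 2) :
    LinearMap.det (R.toLinearEquiv : E →ₗ[ℝ] E) =
      inner ℝ (b 0) (R (b 0)) * inner ℝ (b 1) (R (b 1)) -
        inner ℝ (b 0) (R (b 1)) * inner ℝ (b 1) (R (b 0)) := by
  have hent (i j : Fin 3) : LinearMap.toMatrix b.toBasis b.toBasis
      (R.toLinearEquiv : E →ₗ[ℝ] E) i j = inner ℝ (b i) (R (b j)) := by
    rw [LinearMap.toMatrix_apply, OrthonormalBasis.coe_toBasis,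
      OrthonormalBasis.coe_toBasis_repr_apply, OrthonormalBasis.repr_apply_apply]
    rfl
  rw [← LinearMap.det_toMatrix b.toBasis, Matrix.det_fin_three]
  simp only [hent, inner_basis_two_apply hR, hR, b.inner_eq_ite, Fin.reduceEq, if_true, if_false]
  ring

/-- The rotation `R` about the axis through `b 2`, read as the complex number `exp (iθ)`, where `θ`
is its angle in the plane of `b 0` and `b 1`. -/
noncomputable def rotationNumber (b : OrthonormalBasis (Fin 3) ℝ E) (R : E ≃ₗᵢ[ℝ] E) : ℂ :=
  ⟨inner ℝ (b 0) (R (b 0)), inner ℝ (b 1) (R (b 0))⟩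

theorem rotationNumber_one : rotationNumber b 1 = 1 := by
  refine Complex.ext ?_ ?_ <;> simp [rotationNumber, b.inner_eq_ite]

theorem apply_basis_zero (hR : R (b 2) = b 2) :
    R (b 0) = (rotationNumber b R).re • b 0 + (rotationNumber b R).im • b 1 := by
  have h := eq_sum_inner_smul b (R (b 0))
  rwa [inner_basis_two_apply hR, b.inner_eq_zero (by decide), zero_smul, add_zero] at h

theorem apply_basis_one (hR : R (b 2) = b 2)
    (hdet : LinearMap.det (R.toLinearEquiv : E →ₗ[ℝ] E) = 1) :
    R (b 1) = -(rotationNumber b R).im • b 0 + (rotationNumber b R).re • b 1 := by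
  have hcol (i : Fin 3) (hi : (2 : Fin 3) ≠ i) :
      inner ℝ (b 0) (R (b i)) ^ 2 + inner ℝ (b 1) (R (b i)) ^ 2 = 1 := by
    have h := norm_sq_eq_sum_inner_sq b (R (b i))
    rw [R.norm_map, b.norm_eq_one, inner_basis_two_apply hR, b.inner_eq_zero hi] at h
    linarith
  rw [det_eq_of_apply_basis_two hR] at hdet
  have hsq : (inner ℝ (b 0) (R (b 0)) - inner ℝ (b 1) (R (b 1))) ^ 2 +
      (inner ℝ (b 1) (R (b 0)) + inner ℝ (b 0) (R (b 1))) ^ 2 = 0 := by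
    linear_combination hcol 0 (by decide) + hcol 1 (by decide) - 2 * hdet
  obtain ⟨hre, him⟩ := (add_eq_zero_iff_of_nonneg (sq_nonneg _) (sq_nonneg _)).1 hsq
  have h := eq_sum_inner_smul b (R (b 1))
  rw [inner_basis_two_apply hR, b.inner_eq_zero (by decide), zero_smul, add_zero] at h
  rw [h, ← sub_eq_zero.1 (pow_eq_zero_iff two_ne_zero |>.1 hre),
    eq_neg_of_add_eq_zero_right (pow_eq_zero_iff two_ne_zero |>.1 him)]
  rfl

theorem rotationNumber_mul (hR : R (b 2) = b 2)
    (hdet : LinearMap.det (R.toLinearEquiv : E →ₗ[ℝ] E) = 1) (hS : S (b 2) = b 2) :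
    rotationNumber b (R * S) = rotationNumber b R * rotationNumber b S := by
  have h : (R * S) (b 0) = R (S (b 0)) := rfl
  rw [apply_basis_zero hS, map_add, map_smul, map_smul, apply_basis_zero hR,
    apply_basis_one hR hdet] at h
  refine Complex.ext ?_ ?_
  · rw [rotationNumber, h, Complex.mul_re]
    simp only [inner_add_right, inner_smul_right, b.inner_eq_ite, Fin.reduceEq, if_true, if_false]
    ring
  · rw [rotationNumber, h, Complex.mul_im]
    simp only [inner_add_right, inner_smul_right, b.inner_eq_ite, Fin.reduceEq, if_true, if_false]
    ring

theorem norm_apply_sub_sq (hR : R (b 2) = b 2)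
    (hdet : LinearMap.det (R.toLinearEquiv : E →ₗ[ℝ] E) = 1) (x : E) :
    ‖R x - x‖ ^ 2 = ‖rotationNumber b R - 1‖ ^ 2 * (‖x‖ ^ 2 - inner ℝ x (b 2) ^ 2) := by
  set z := rotationNumber b R
  have hx : R x - x =
      ((z.re - 1) * inner ℝ (b 0) x - z.im * inner ℝ (b 1) x) • b 0 +
        (z.im * inner ℝ (b 0) x + (z.re - 1) * inner ℝ (b 1) x) • b 1 := by
    conv_lhs => rw [eq_sum_inner_smul b x]
    simp only [map_add, map_smul, apply_basis_zero hR, apply_basis_one hR hdet, hR]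
    module
  rw [hx, norm_add_sq_real, inner_smul_left, inner_smul_right, b.inner_eq_zero (by decide),
    norm_smul, norm_smul, b.norm_eq_one, b.norm_eq_one, norm_sq_eq_sum_inner_sq b x,
    real_inner_comm (b 2) x, Complex.sq_norm, Complex.normSq_apply]
  simp only [mul_one, mul_zero, add_zero, Real.norm_eq_abs, sq_abs, Complex.sub_re,
    Complex.sub_im, Complex.one_re, Complex.one_im, sub_zero]
  ring

theorem exists_orthonormalBasis_apply_two (hE : Module.finrank ℝ E = 3) {p : E} (hp : ‖p‖ = 1) :
    ∃ b : OrthonormalBasis (Fin 3) ℝ E, b 2 = p := by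
  have : FiniteDimensional ℝ E := Module.finite_of_finrank_eq_succ hE
  have h : Orthonormal ℝ (({2} : Set (Fin 3)).domRestrict fun _ => p) :=
    ⟨fun _ => hp, fun i j hij => absurd (Subsingleton.elim i j) hij⟩
  obtain ⟨b, hb⟩ := h.exists_orthonormalBasis_extension_of_card_eq (by simpa using hE)
  exact ⟨b, hb 2 rfl⟩

end Rotation

theorem crossNorm_nonneg (x p : R3) : 0 ≤ crossNorm x p := norm_nonneg _

theorem crossNorm_sq (x p : R3) : crossNorm x p ^ 2 = ‖x‖ ^ 2 * ‖p‖ ^ 2 - inner ℝ x p ^ 2 := by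
  rw [crossNorm, ← real_inner_self_eq_norm_sq, ← real_inner_self_eq_norm_sq x,
    ← real_inner_self_eq_norm_sq p, EuclideanSpace.inner_toLp_toLp]
  simp only [EuclideanSpace.inner_eq_star_dotProduct, star_trivial, cross_dot_cross]
  rw [dotProduct_comm (WithLp.ofLp p) (WithLp.ofLp x)]
  ring

theorem crossNorm_le (x p : R3) : crossNorm x p ≤ ‖x‖ * ‖p‖ := by
  refine le_of_sq_le_sq ?_ (by positivity)
  rw [crossNorm_sq, mul_pow]
  exact sub_le_self _ (sq_nonneg _)

theorem eq_or_eq_neg_of_crossNorm_eq_zero {p q : R3} (hp : ‖p‖ = 1) (hq : ‖q‖ = 1)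
    (h : crossNorm q p = 0) : q = p ∨ q = -p := by
  have hsq := crossNorm_sq q p
  rw [h, hp, hq] at hsq
  have hmul : (inner ℝ q p - 1) * (inner ℝ q p + 1) = (0 : ℝ) := by linear_combination hsq
  refine (mul_eq_zero.1 hmul).imp (fun h => ?_) fun h => ?_
  · exact (inner_eq_one_iff_of_norm_eq_one (𝕜 := ℝ) hq hp).1 (sub_eq_zero.1 h)
  · refine (inner_eq_one_iff_of_norm_eq_one (𝕜 := ℝ) hq ((norm_neg p).trans hp)).1 ?_
    rw [inner_neg_right, eq_neg_of_add_eq_zero_left h, neg_neg]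

theorem norm_apply_sub {b : OrthonormalBasis (Fin 3) ℝ R3} {R : R3 ≃ₗᵢ[ℝ] R3}
    (hR : R (b 2) = b 2) (hdet : LinearMap.det (R.toLinearEquiv : R3 →ₗ[ℝ] R3) = 1) (x : R3) :
    ‖R x - x‖ = ‖rotationNumber b R - 1‖ * crossNorm x (b 2) := by
  refine (pow_left_inj₀ (norm_nonneg _)
    (mul_nonneg (norm_nonneg _) (crossNorm_nonneg _ _)) two_ne_zero).1 ?_
  rw [norm_apply_sub_sq hR hdet, mul_pow, crossNorm_sq, b.norm_eq_one, one_pow, mul_one]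

theorem eq_one_of_rotationNumber_eq_one {b : OrthonormalBasis (Fin 3) ℝ R3}
    {R : R3 ≃ₗᵢ[ℝ] R3} (hR : R (b 2) = b 2)
    (hdet : LinearMap.det (R.toLinearEquiv : R3 →ₗ[ℝ] R3) = 1) (h : rotationNumber b R = 1) :
    R = 1 := by
  ext1 x
  have hx := norm_apply_sub hR hdet x
  rw [h, sub_self, norm_zero, zero_mul, norm_eq_zero] at hx
  exact sub_eq_zero.1 hx

theorem eq_or_eq_neg_of_apply_eq {R : R3 ≃ₗᵢ[ℝ] R3}
    (hdet : LinearMap.det (R.toLinearEquiv : R3 →ₗ[ℝ] R3) = 1) (hR : R ≠ 1) {p q : R3}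
    (hp : ‖p‖ = 1) (hq : ‖q‖ = 1) (hRp : R p = p) (hRq : R q = q) : q = p ∨ q = -p := by
  obtain ⟨b, rfl⟩ := exists_orthonormalBasis_apply_two (by simp) hp
  refine eq_or_eq_neg_of_crossNorm_eq_zero hp hq ?_
  have h := norm_apply_sub hRp hdet q
  rw [hRq, sub_self, norm_zero] at h
  exact (mul_eq_zero.1 h.symm).resolve_left fun h0 =>
    hR (eq_one_of_rotationNumber_eq_one hRp hdet (sub_eq_zero.1 (norm_eq_zero.1 h0)))

/-! ### The stabilizer of a pole -/

section Character

variable {K L A : Type*} [CommRing L] [IsDomain L]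

theorem image_pow_primitiveRoot [DecidableEq L] {n : ℕ} (hn : 0 < n) {ζ : L}
    (hζ : IsPrimitiveRoot ζ n) :
    (Finset.range n).image (ζ ^ ·) = Polynomial.nthRootsFinset n (1 : L) := by
  refine Finset.eq_of_subset_of_card_le (fun z hz => ?_) ?_
  · obtain ⟨j, -, rfl⟩ := Finset.mem_image.1 hz
    rw [Polynomial.mem_nthRootsFinset hn, ← pow_mul, mul_comm, pow_mul, hζ.pow_eq_one, one_pow]
  · rw [hζ.card_nthRootsFinset, Finset.card_image_of_injOn hζ.injOn_pow, Finset.card_range]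

variable [Group K] [Fintype K] [AddCommMonoid A]

theorem image_injective_character [DecidableEq L] {χ : K →* L} (hχ : Function.Injective χ)
    {ζ : L} (hζ : IsPrimitiveRoot ζ (Nat.card K)) :
    Finset.univ.image χ = Polynomial.nthRootsFinset (Nat.card K) (1 : L) := by
  refine Finset.eq_of_subset_of_card_le (fun z hz => ?_) ?_
  · obtain ⟨R, -, rfl⟩ := Finset.mem_image.1 hz
    rw [Polynomial.mem_nthRootsFinset Nat.card_pos, ← map_pow, pow_card_eq_one', map_one]
  · rw [hζ.card_nthRootsFinset, Finset.card_image_of_injective _ hχ, Finset.card_univ,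
      Nat.card_eq_fintype_card]

theorem sum_comp_character {χ : K →* L} (hχ : Function.Injective χ) {ζ : L}
    (hζ : IsPrimitiveRoot ζ (Nat.card K)) (f : L → A) :
    ∑ R : K, f (χ R) = ∑ j ∈ Finset.range (Nat.card K), f (ζ ^ j) := by
  classical
  rw [← Finset.sum_image (s := Finset.univ) hχ.injOn, image_injective_character hχ hζ,
    ← image_pow_primitiveRoot Nat.card_pos hζ, Finset.sum_image hζ.injOn_pow]

end Character

theorem sin_mul_pi_div_nonneg {j o : ℕ} (hj : j ≤ o) : 0 ≤ Real.sin (j * Real.pi / o) := by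
  refine Real.sin_nonneg_of_nonneg_of_le_pi (by positivity) ?_
  rw [mul_div_right_comm]
  exact mul_le_of_le_one_left Real.pi_pos.le
    (div_le_one_of_le₀ (by exact_mod_cast hj) o.cast_nonneg)

theorem norm_exp_pow_sub_one {j o : ℕ} (hj : j ≤ o) :
    ‖Complex.exp (2 * Real.pi * Complex.I / o) ^ j - 1‖ = 2 * Real.sin (j * Real.pi / o) := by
  have hexp : Complex.exp (2 * Real.pi * Complex.I / o) ^ j =
      Complex.exp (Complex.I * ((2 * (j * Real.pi / o) : ℝ) : ℂ)) := by
    rw [← Complex.exp_nat_mul]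
    congr 1
    push_cast
    ring
  rw [hexp, Complex.norm_exp_I_mul_ofReal_sub_one, mul_div_cancel_left₀ _ two_ne_zero,
    Real.norm_of_nonneg (mul_nonneg two_pos.le (sin_mul_pi_div_nonneg hj))]

theorem sum_one_div_norm_character_sub_one {K : Type*} [Group K] [Fintype K] {χ : K →* ℂ}
    (hχ : Function.Injective χ) {α : ℝ} (hα : α ≠ 0) :
    ∑ R : K, 1 / ‖χ R - 1‖ ^ α =
      (∑ j ∈ Finset.Ico 1 (Nat.card K), 1 / Real.sin (j * Real.pi / Nat.card K) ^ α) / 2 ^ α := by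
  have hpos : 0 < Nat.card K := Nat.card_pos
  rw [sum_comp_character hχ (Complex.isPrimitiveRoot_exp _ hpos.ne') fun z => 1 / ‖z - 1‖ ^ α,
    Finset.sum_div, Finset.range_eq_Ico, Finset.sum_eq_sum_Ico_succ_bot hpos, pow_zero, sub_self,
    norm_zero, Real.zero_rpow hα, div_zero, zero_add]
  refine Finset.sum_congr rfl fun j hj => ?_
  have hj' := (Finset.mem_Ico.1 hj).2.le
  rw [norm_exp_pow_sub_one hj', Real.mul_rpow zero_le_two (sin_mul_pi_div_nonneg hj'), div_div,
    mul_comm]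

theorem poleCoeff_nonneg (G : Subgroup (R3 ≃ₗᵢ[ℝ] R3)) (α : ℝ) (p : R3) : 0 ≤ poleCoeff G α p :=
  Finset.sum_nonneg fun _ hj => div_nonneg zero_le_one
    (Real.rpow_nonneg (sin_mul_pi_div_nonneg (Finset.mem_Ico.1 hj).2.le) _)

/-- The subgroup of the elements of `G` that fix `p`; its cardinality is `poleOrder G p`. -/
def axisStabilizer (G : Subgroup (R3 ≃ₗᵢ[ℝ] R3)) (p : R3) : Subgroup (R3 ≃ₗᵢ[ℝ] R3) where
  carrier := {R | R ∈ G ∧ R p = p}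
  one_mem' := ⟨one_mem _, rfl⟩
  mul_mem' := fun {R _} hR hS => ⟨mul_mem hR.1 hS.1, (congrArg R hS.2).trans hR.2⟩
  inv_mem' := fun {R} hR => ⟨inv_mem hR.1, R.symm_apply_eq.2 hR.2.symm⟩

theorem exists_axisStabilizer_character {G : Subgroup (R3 ≃ₗᵢ[ℝ] R3)}
    (hG : ∀ R ∈ G, LinearMap.det (R.toLinearEquiv : R3 →ₗ[ℝ] R3) = 1) {p : R3} (hp : ‖p‖ = 1) :
    ∃ χ : axisStabilizer G p →* ℂ, Function.Injective χ ∧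
      ∀ (R : axisStabilizer G p) (x : R3), ‖R.1 x - x‖ = ‖χ R - 1‖ * crossNorm x p := by
  obtain ⟨b, rfl⟩ := exists_orthonormalBasis_apply_two (by simp) hp
  refine ⟨⟨⟨fun R => rotationNumber b R.1, rotationNumber_one⟩,
      fun R S => rotationNumber_mul R.2.2 (hG R.1 R.2.1) S.2.2⟩, ?_,
    fun R => norm_apply_sub R.2.2 (hG R.1 R.2.1)⟩
  exact (injective_iff_map_eq_one _).2 fun R hR =>
    Subtype.ext (eq_one_of_rotationNumber_eq_one R.2.2 (hG R.1 R.2.1) hR)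

/-! ### The potential of the satellites -/

/-- The potential that the satellites `R x`, `R ≠ 1`, exert on the generating particle at `x`, as it
enters `action`. -/
noncomputable def satellitePotential (G : Subgroup (R3 ≃ₗᵢ[ℝ] R3)) (α : ℝ) (x : R3) : ℝ≥0∞ :=
  ∑' R : {R : R3 ≃ₗᵢ[ℝ] R3 // R ∈ G ∧ R ≠ 1}, 1 / ‖R.1 x - x‖ₑ ^ α

section Potential

variable {G : Subgroup (R3 ≃ₗᵢ[ℝ] R3)} {α : ℝ}

theorem satellitePotential_smul (hα : 0 ≤ α) (r : ℝ) (x : R3) :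
    satellitePotential G α (r • x) = satellitePotential G α x / ‖r‖ₑ ^ α := by
  rw [satellitePotential, satellitePotential, ENNReal.div_eq_inv_mul, ← ENNReal.tsum_mul_left]
  refine tsum_congr fun R => ?_
  have hr : ‖r‖ₑ ^ α ≠ ⊤ := ENNReal.rpow_ne_top_of_nonneg hα enorm_ne_top
  have hx : ‖R.1 x - x‖ₑ ^ α ≠ ⊤ := ENNReal.rpow_ne_top_of_nonneg hα enorm_ne_top
  rw [map_smul, ← smul_sub, enorm_smul, ENNReal.mul_rpow_of_nonneg _ _ hα, one_div, one_div,
    ENNReal.mul_inv (Or.inr hx) (Or.inl hr)]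

theorem satellitePotential_apply {g : R3 ≃ₗᵢ[ℝ] R3}
    (hg : g ∈ Subgroup.normalizer (G : Set (R3 ≃ₗᵢ[ℝ] R3))) (x : R3) :
    satellitePotential G α (g x) = satellitePotential G α x := by
  have hconj (R : R3 ≃ₗᵢ[ℝ] R3) :
      (R ∈ G ∧ R ≠ 1) ↔ (MulAut.conj g R ∈ G ∧ MulAut.conj g R ≠ 1) :=
    and_congr (Subgroup.mem_normalizer_iff.1 hg R) (map_ne_one_iff _ (MulAut.conj g).injective).symm
  refine (Equiv.tsum_eq ((MulAut.conj g).toEquiv.subtypeEquiv hconj) _).symm.trans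
    (tsum_congr fun R => ?_)
  have h : (MulAut.conj g R.1) (g x) = g (R.1 x) :=
    congrArg (fun y => g (R.1 y)) (g.symm_apply_apply x)
  change 1 / ‖(MulAut.conj g R.1) (g x) - g x‖ₑ ^ α = _
  rw [h, ← map_sub, g.enorm_map]

theorem satellitePotential_eq_tsum_indicator (x : R3) :
    satellitePotential G α x =
      ∑' R, {R | R ∈ G ∧ R ≠ 1}.indicator (fun R => 1 / ‖R x - x‖ₑ ^ α) R :=
  tsum_subtype {R | R ∈ G ∧ R ≠ 1} fun R => 1 / ‖R x - x‖ₑ ^ α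

theorem encard_unit_fixedPoints_le_two {R : R3 ≃ₗᵢ[ℝ] R3}
    (hdet : LinearMap.det (R.toLinearEquiv : R3 →ₗ[ℝ] R3) = 1) (hR : R ≠ 1) :
    {p : R3 | ‖p‖ = 1 ∧ R p = p}.encard ≤ 2 := by
  rcases {p : R3 | ‖p‖ = 1 ∧ R p = p}.eq_empty_or_nonempty with h | ⟨p, hp, hRp⟩
  · rw [h, encard_empty]
    exact zero_le
  · have hsub : {p : R3 | ‖p‖ = 1 ∧ R p = p} ⊆ {p, -p} := fun q hq =>
      eq_or_eq_neg_of_apply_eq hdet hR hp hq.1 hRp hq.2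
    refine (encard_le_encard hsub).trans ((encard_insert_le _ _).trans_eq ?_)
    rw [encard_singleton, one_add_one_eq_two]

theorem norm_eq_one_of_mem_poles {p : R3} (hp : p ∈ poles G) : ‖p‖ = 1 :=
  mem_sphere_zero_iff_norm.1 hp.2

theorem tsum_poles_tsum_axisStabilizer_le
    (hG : ∀ R ∈ G, LinearMap.det (R.toLinearEquiv : R3 →ₗ[ℝ] R3) = 1)
    {f : (R3 ≃ₗᵢ[ℝ] R3) → ℝ≥0∞} (hf : Function.support f ⊆ {R | R ∈ G ∧ R ≠ 1}) :
    ∑' p : poles G, ∑' R : axisStabilizer G p, f R ≤ 2 * ∑' R, f R := by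
  have hstab (p : poles G) : ∑' R : axisStabilizer G p, f R =
      ∑' R, {q : poles G | R q.1 = q.1}.indicator (fun _ => f R) p := by
    refine (tsum_subtype (axisStabilizer G p.1 : Set (R3 ≃ₗᵢ[ℝ] R3)) f).trans
      (tsum_congr fun R => ?_)
    by_cases hR : R ∈ G
    · by_cases hRp : R p = p
      · exact (indicator_of_mem (show R ∈ axisStabilizer G p.1 from ⟨hR, hRp⟩) f).trans
          (indicator_of_mem (s := {q : poles G | R q.1 = q.1}) hRp fun _ => f R).symm
      · exact (indicator_of_notMem (fun h => hRp h.2) f).trans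
          (indicator_of_notMem (s := {q : poles G | R q.1 = q.1}) hRp fun _ => f R).symm
    · have hR0 : f R = 0 := Function.notMem_support.1 fun h => hR (hf h).1
      simp [indicator, hR0]
  rw [tsum_congr hstab, ENNReal.tsum_comm, ← ENNReal.tsum_mul_left]
  refine ENNReal.tsum_le_tsum fun R => ?_
  rw [← tsum_subtype, ENNReal.tsum_set_const]
  by_cases hR : R ∈ Function.support f
  · have hfix : {q : poles G | R q.1 = q.1}.encard ≤ 2 := by
      rw [← Subtype.val_injective.encard_image]
      refine (encard_le_encard ?_).trans
        (encard_unit_fixedPoints_le_two (hG R (hf hR).1) (hf hR).2)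
      rintro _ ⟨q, hq, rfl⟩
      exact ⟨norm_eq_one_of_mem_poles q.2, hq⟩
    gcongr
    exact_mod_cast ENat.toENNReal_le.2 hfix
  · rw [Function.notMem_support.1 hR, mul_zero, mul_zero]

theorem tsum_axisStabilizer_one_div [Finite G]
    (hG : ∀ R ∈ G, LinearMap.det (R.toLinearEquiv : R3 →ₗ[ℝ] R3) = 1) (hα : 0 < α)
    {p : R3} (hp : ‖p‖ = 1) (x : R3) :
    ∑' R : axisStabilizer G p,
        {R | R ∈ G ∧ R ≠ 1}.indicator (fun R => 1 / ‖R x - x‖ₑ ^ α) R.1 =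
      ENNReal.ofReal (poleCoeff G α p / 2 ^ α) / ‖crossNorm x p‖ₑ ^ α := by
  have : Finite (axisStabilizer G p) :=
    Finite.Set.subset (G : Set (R3 ≃ₗᵢ[ℝ] R3)) fun _ hR => hR.1
  have := Fintype.ofFinite (axisStabilizer G p)
  obtain ⟨χ, hχ, hnorm⟩ := exists_axisStabilizer_character hG hp
  have hsum : poleCoeff G α p / 2 ^ α = ∑ R, 1 / ‖χ R - 1‖ ^ α :=
    (sum_one_div_norm_character_sub_one hχ hα.ne').symm
  rw [hsum, tsum_fintype, ENNReal.ofReal_sum_of_nonneg fun R _ => by positivity,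
    ENNReal.div_eq_inv_mul, Finset.mul_sum]
  refine Finset.sum_congr rfl fun R _ => ?_
  rcases eq_or_ne R 1 with rfl | hR
  · simp [Real.zero_rpow hα.ne']
  · have hχR : 0 < ‖χ R - 1‖ := norm_pos_iff.2 (sub_ne_zero.2 ((map_ne_one_iff χ hχ).2 hR))
    have henorm : ‖R.1 x - x‖ₑ = ‖χ R - 1‖ₑ * ‖crossNorm x p‖ₑ := by
      rw [← enorm_norm, hnorm, enorm_mul, enorm_norm]
    have hinv : ENNReal.ofReal (1 / ‖χ R - 1‖ ^ α) = (‖χ R - 1‖ₑ ^ α)⁻¹ := by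
      rw [one_div, ENNReal.ofReal_inv_of_pos (by positivity), ← ENNReal.ofReal_rpow_of_pos hχR,
        ofReal_norm]
    have hmem : R.1 ∈ {R | R ∈ G ∧ R ≠ 1} := ⟨R.2.1, fun h => hR (Subtype.ext h)⟩
    rw [indicator_of_mem hmem, henorm, ENNReal.mul_rpow_of_nonneg _ _ hα.le, one_div, hinv,
      ENNReal.mul_inv (Or.inr (ENNReal.rpow_ne_top_of_nonneg hα.le enorm_ne_top))
        (Or.inl (ENNReal.rpow_ne_top_of_nonneg hα.le enorm_ne_top)), mul_comm]

theorem ofReal_finsum_le_tsum {ι : Type*} {f : ι → ℝ} (hf : ∀ i, 0 ≤ f i) :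
    ENNReal.ofReal (∑ᶠ i, f i) ≤ ∑' i, ENNReal.ofReal (f i) := by
  by_cases hfin : (Function.support f).Finite
  · rw [finsum_eq_sum _ hfin, ENNReal.ofReal_sum_of_nonneg fun i _ => hf i]
    exact ENNReal.sum_le_tsum _
  · rw [finsum_of_infinite_support hfin, ENNReal.ofReal_zero]
    exact zero_le

theorem ofReal_div_le_div_enorm_rpow {a c s : ℝ} (hc : 0 ≤ c) (hα : 0 ≤ α)
    (hs : c ^ α ≤ s) : ENNReal.ofReal (a / s) ≤ ENNReal.ofReal a / ‖c‖ₑ ^ α := by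
  rcases (Real.rpow_nonneg hc α).trans hs |>.eq_or_lt with h0 | h0
  · rw [← h0, div_zero, ENNReal.ofReal_zero]
    exact zero_le
  · rw [ENNReal.ofReal_div_of_pos h0, Real.enorm_of_nonneg hc,
      ENNReal.ofReal_rpow_of_nonneg hc hα]
    gcongr

theorem crossNorm_rpow_le_sSup (hα : 0 ≤ α) {K : Set R3} (hK : Bornology.IsBounded K) {y : R3}
    (hy : y ∈ K) (p : R3) : crossNorm y p ^ α ≤ sSup ((fun x => crossNorm x p ^ α) '' K) := by
  obtain ⟨C, hC⟩ := hK.exists_norm_le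
  refine le_csSup ⟨(C * ‖p‖) ^ α, ?_⟩ ⟨y, hy, rfl⟩
  rintro _ ⟨x, hx, rfl⟩
  exact Real.rpow_le_rpow (crossNorm_nonneg _ _) ((crossNorm_le x p).trans
    (mul_le_mul_of_nonneg_right (hC x hx) (norm_nonneg p))) hα

theorem potentialBound_nonneg (τ : Set R3) : 0 ≤ potentialBound G τ α := by
  refine mul_nonneg (by positivity) (finsum_nonneg fun p => ?_)
  refine div_nonneg (poleCoeff_nonneg _ _ _) (Real.sSup_nonneg ?_)
  rintro _ ⟨x, -, rfl⟩
  exact Real.rpow_nonneg (crossNorm_nonneg _ _) _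

theorem ofReal_potentialBound_le [Finite G]
    (hG : ∀ R ∈ G, LinearMap.det (R.toLinearEquiv : R3 →ₗ[ℝ] R3) = 1) (hα : 0 < α)
    {τ : Set R3} (hτ : Bornology.IsBounded τ) {y : R3} (hy : y ∈ closure τ) :
    ENNReal.ofReal (potentialBound G τ α) ≤ satellitePotential G α y := by
  set s : R3 → ℝ := fun p => sSup ((fun x => crossNorm x p ^ α) '' closure τ)
  have hs (p : R3) : crossNorm y p ^ α ≤ s p := crossNorm_rpow_le_sSup hα.le hτ.closure hy p
  have hk (p : R3) : 0 ≤ poleCoeff G α p / 2 ^ α :=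
    div_nonneg (poleCoeff_nonneg G α p) (by positivity)
  have hbound : potentialBound G τ α = 1 / 2 * ∑ᶠ p : poles G, poleCoeff G α p / 2 ^ α / s p := by
    have hterm (p : poles G) : poleCoeff G α p / s p = 2 ^ α * (poleCoeff G α p / 2 ^ α / s p) := by
      field_simp
    rw [potentialBound, Real.rpow_add_one two_ne_zero, finsum_congr hterm, ← mul_finsum]
    field_simp
  calc ENNReal.ofReal (potentialBound G τ α)
      ≤ 1 / 2 * ∑' p : poles G, ENNReal.ofReal (poleCoeff G α p / 2 ^ α / s p) := by
        rw [hbound, ENNReal.ofReal_mul (by norm_num), ENNReal.ofReal_div_of_pos two_pos,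
          ENNReal.ofReal_one, ENNReal.ofReal_ofNat]
        gcongr
        exact ofReal_finsum_le_tsum fun p =>
          div_nonneg (hk p) ((Real.rpow_nonneg (crossNorm_nonneg y p) α).trans (hs p))
    _ ≤ 1 / 2 * ∑' p : poles G, ∑' R : axisStabilizer G p,
          {R | R ∈ G ∧ R ≠ 1}.indicator (fun R => 1 / ‖R y - y‖ₑ ^ α) R.1 := by
        gcongr with p
        rw [tsum_axisStabilizer_one_div hG hα (norm_eq_one_of_mem_poles p.2)]
        exact ofReal_div_le_div_enorm_rpow (crossNorm_nonneg y p) hα.le (hs p)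
    _ ≤ 1 / 2 * (2 * satellitePotential G α y) := by
        rw [satellitePotential_eq_tsum_indicator]
        gcongr
        exact tsum_poles_tsum_axisStabilizer_le hG support_indicator_subset
    _ = satellitePotential G α y := by
        rw [← mul_assoc, one_div, ENNReal.inv_mul_cancel two_ne_zero ENNReal.ofNat_ne_top, one_mul]

end Potential

/-! ### The tessellation -/

section Tessellation

theorem exists_apply_inner_mul_inner_nonneg {E : Type*} [NormedAddCommGroup E]
    [InnerProductSpace ℝ E] (G : Subgroup (E ≃ₗᵢ[ℝ] E)) [Finite G] (x₀ x : E) :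
    ∃ g ∈ G, ∀ n : E, (Submodule.span ℝ {n})ᗮ.reflection ∈ G →
      0 ≤ inner ℝ n x₀ * inner ℝ n (g x) := by
  -- Among the points `g x`, the one nearest to `x₀` lies on the side of `x₀` of every mirror.
  obtain ⟨g, hg⟩ := Finite.exists_max fun g : G => inner ℝ x₀ (g.1 x)
  refine ⟨g.1, g.2, fun n hn => ?_⟩
  have hmax : inner ℝ x₀ ((Submodule.span ℝ {n})ᗮ.reflection (g.1 x)) ≤ inner ℝ x₀ (g.1 x) :=
    hg ((⟨(Submodule.span ℝ {n})ᗮ.reflection, hn⟩ : G) * g)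
  rw [Submodule.reflection_orthogonal_apply, Submodule.reflection_singleton_apply, neg_sub,
    inner_sub_right, two_smul, inner_add_right, inner_smul_right, real_inner_comm n x₀] at hmax
  simp only [RCLike.ofReal_real_eq_id, id_eq] at hmax
  rcases eq_or_ne n 0 with rfl | hn0
  · simp
  · have hquot : 0 ≤ inner ℝ n (g.1 x) / ‖n‖ ^ 2 * inner ℝ n x₀ := by linarith
    rwa [div_mul_eq_mul_div, le_div_iff₀ (by positivity), zero_mul, mul_comm] at hquot

theorem lineMap_ne_zero_of_mul_nonneg {a b t : ℝ} (ha : a ≠ 0) (hab : 0 ≤ a * b)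
    (ht : t ∈ Ico (0 : ℝ) 1) : AffineMap.lineMap a b t ≠ 0 := by
  rw [AffineMap.lineMap_apply_ring']
  intro h
  have hsq : (1 - t) * a ^ 2 + t * (a * b) = 0 := by linear_combination a * h
  have hpos : 0 < (1 - t) * a ^ 2 := mul_pos (sub_pos.2 ht.2) (by positivity)
  linarith [mul_nonneg ht.1 hab]

theorem mem_closure_connectedComponentIn {X : Type*} [TopologicalSpace X] {F : Set X}
    {γ : ℝ → X} (hγ : ContinuousOn γ (Icc 0 1)) (hF : MapsTo γ (Ico 0 1) F) :
    γ 1 ∈ closure (connectedComponentIn F (γ 0)) := by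
  have hcl : closure (Ico (0 : ℝ) 1) = Icc 0 1 := closure_Ico zero_ne_one
  have hsub : γ '' Ico 0 1 ⊆ connectedComponentIn F (γ 0) :=
    (isPreconnected_Ico.image _ (hγ.mono Ico_subset_Icc_self)).subset_connectedComponentIn
      (mem_image_of_mem γ (left_mem_Ico.2 one_pos)) hF.image_subset
  refine closure_mono hsub ((hcl ▸ hγ).image_closure (mem_image_of_mem γ ?_))
  rw [hcl]
  exact right_mem_Icc.2 zero_le_one

theorem mem_closure_connectedComponentIn_sphere {E : Type*} [NormedAddCommGroup E]
    [NormedSpace ℝ E] {Z : Set E} (hZ0 : 0 ∈ Z) (hZ : ∀ (r : ℝ) (x : E), r ≠ 0 → r • x ∈ Z → x ∈ Z)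
    {x y : E} (hx : ‖x‖ = 1) (hy : ‖y‖ = 1)
    (hxy : ∀ t ∈ Ico (0 : ℝ) 1, AffineMap.lineMap x y t ∉ Z) :
    y ∈ closure (connectedComponentIn (Metric.sphere 0 1 \ Z) x) := by
  set s : ℝ → E := fun t => AffineMap.lineMap x y t
  have hs : Continuous s := AffineMap.lineMap_continuous
  have hs1 : s 1 = y := AffineMap.lineMap_apply_one x y
  have hs0 : s 0 = x := AffineMap.lineMap_apply_zero x y
  have hne (t : ℝ) (ht : t ∈ Icc (0 : ℝ) 1) : ‖s t‖ ≠ 0 := by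
    rcases ht.2.lt_or_eq with h | rfl
    · exact fun h0 => hxy t ⟨ht.1, h⟩ (by rwa [← norm_eq_zero.1 h0] at hZ0)
    · rw [hs1, hy]
      exact one_ne_zero
  have h := mem_closure_connectedComponentIn (F := Metric.sphere 0 1 \ Z)
    (γ := fun t => ‖s t‖⁻¹ • s t)
    ((hs.norm.continuousOn.inv₀ hne).smul hs.continuousOn) fun t ht => ⟨?_, fun h =>
      hxy t ht (hZ _ _ (inv_ne_zero (hne t (Ico_subset_Icc_self ht))) h)⟩
  · simpa only [hs0, hs1, hx, hy, inv_one, one_smul] using h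
  · rw [mem_sphere_zero_iff_norm, norm_smul, norm_inv, norm_norm,
      inv_mul_cancel₀ (hne t (Ico_subset_Icc_self ht))]

variable {G : Subgroup (R3 ≃ₗᵢ[ℝ] R3)}

theorem mem_mirrors_of_smul_mem (r : ℝ) (x : R3) (hr : r ≠ 0) (h : r • x ∈ mirrors G) :
    x ∈ mirrors G := by
  obtain ⟨n, hn, hnG, hnx⟩ := h
  rw [inner_smul_right] at hnx
  exact ⟨n, hn, hnG, (mul_eq_zero.1 hnx).resolve_left hr⟩

theorem connectedComponentIn_unit_sphere {x : R3} (hx : ‖x‖ = 1) :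
    connectedComponentIn (Metric.sphere (0 : R3) 1) x = Metric.sphere 0 1 := by
  have hrank : 1 < Module.rank ℝ R3 := by
    rw [← Module.finrank_eq_rank, finrank_euclideanSpace_fin]
    norm_num
  exact (isPreconnected_sphere hrank 0 1).connectedComponentIn (mem_sphere_zero_iff_norm.2 hx)

theorem exists_apply_mem_closure_of_mem_tessellation [Finite G] {τ : Set R3}
    (hτ : τ ∈ tessellation G) {x : R3} (hx : ‖x‖ = 1) : ∃ g ∈ G, g x ∈ closure τ := by
  obtain ⟨x₀, ⟨hx₀, hx₀m⟩, rfl⟩ := hτ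
  rw [mem_sphere_zero_iff_norm] at hx₀
  obtain ⟨g, hg, hsign⟩ := exists_apply_inner_mul_inner_nonneg G x₀ x
  refine ⟨g, hg, ?_⟩
  have hgx : ‖g x‖ = 1 := (g.norm_map x).trans hx
  rcases (mirrors G).eq_empty_or_nonempty with hm | ⟨_, n, hn, hnG, -⟩
  · rw [hm, sdiff_empty, connectedComponentIn_unit_sphere hx₀]
    exact subset_closure (mem_sphere_zero_iff_norm.2 hgx)
  · refine mem_closure_connectedComponentIn_sphere (Z := mirrors G)
      ⟨n, hn, hnG, inner_zero_right n⟩ mem_mirrors_of_smul_mem hx₀ hgx ?_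
    rintro t ht ⟨k, hk, hkG, hkt⟩
    have hk₀ : inner ℝ k x₀ ≠ 0 := fun h => hx₀m ⟨k, hk, hkG, h⟩
    refine lineMap_ne_zero_of_mul_nonneg hk₀ (hsign k hkG) ht ?_
    rw [← hkt, AffineMap.lineMap_apply_module, AffineMap.lineMap_apply_module, inner_add_right,
      inner_smul_right, inner_smul_right, smul_eq_mul, smul_eq_mul]

theorem subset_sphere_of_mem_tessellation {τ : Set R3} (hτ : τ ∈ tessellation G) :
    τ ⊆ Metric.sphere 0 1 := by
  obtain ⟨x₀, -, rfl⟩ := hτ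
  exact (connectedComponentIn_subset _ _).trans sdiff_subset

theorem ofReal_potentialBound_div_le {H : Subgroup (R3 ≃ₗᵢ[ℝ] R3)} [Finite G] [Finite H]
    (hG : ∀ R ∈ G, LinearMap.det (R.toLinearEquiv : R3 →ₗ[ℝ] R3) = 1)
    (hH : H ≤ Subgroup.normalizer (G : Set (R3 ≃ₗᵢ[ℝ] R3))) {τ : Set R3}
    (hτ : τ ∈ tessellation H) {α : ℝ} (hα : 0 < α) (x : R3) :
    ENNReal.ofReal (potentialBound G τ α) / ‖x‖ₑ ^ α ≤ satellitePotential G α x := by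
  obtain ⟨y, hy, hxy⟩ : ∃ y : R3, ‖y‖ = 1 ∧ x = ‖x‖ • y := by
    rcases eq_or_ne x 0 with rfl | hx
    · obtain ⟨y, hy⟩ := exists_norm_eq R3 zero_le_one
      exact ⟨y, hy, by rw [norm_zero, zero_smul]⟩
    · exact ⟨‖x‖⁻¹ • x, norm_smul_inv_norm hx, (smul_inv_smul₀ (norm_ne_zero_iff.2 hx) x).symm⟩
  obtain ⟨g, hg, hgy⟩ := exists_apply_mem_closure_of_mem_tessellation hτ hy
  have hτ' : Bornology.IsBounded τ :=
    Metric.isBounded_sphere.subset (subset_sphere_of_mem_tessellation hτ)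
  rw [hxy, satellitePotential_smul hα.le, ← hxy, enorm_norm, ← satellitePotential_apply (hH hg)]
  gcongr
  exact ofReal_potentialBound_le hG hα hτ' hgy

end Tessellation

/-! ### The symmetry groups of the Platonic polyhedra -/

section Platonic

theorem finite_setOf_forall_abs_apply_mem {ι : Type*} [Finite ι] {C : Set ℝ} (hC : C.Finite) :
    {x : EuclideanSpace ℝ ι | ∀ i, |x i| ∈ C}.Finite := by
  have hpre : (abs ⁻¹' C : Set ℝ).Finite := by
    refine (hC.union hC.neg).subset fun a ha => (abs_choice a).imp (fun h => ?_) fun h => ?_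
    · rwa [← h]
    · rwa [Set.mem_neg, ← h]
  exact (Set.Finite.pi' fun _ : ι => hpre).preimage (WithLp.ofLp_injective 2).injOn

theorem forall_fin_three_of_add {p : Fin 3 → Prop} (i : Fin 3) (h₀ : p i) (h₁ : p (i + 1))
    (h₂ : p (i + 2)) (j : Fin 3) : p j := by
  fin_cases i <;> fin_cases j <;> assumption

theorem span_eq_top_of_forall_single_mem {ι : Type*} [Finite ι] [DecidableEq ι]
    {P : Set (EuclideanSpace ℝ ι)}
    (h : ∀ i, EuclideanSpace.single i 1 ∈ Submodule.span ℝ P) : Submodule.span ℝ P = ⊤ := by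
  have := Fintype.ofFinite ι
  rw [eq_top_iff, ← (EuclideanSpace.basisFun ι ℝ).toBasis.span_eq, Submodule.span_le]
  rintro _ ⟨i, rfl⟩
  simpa using h i

theorem tetrahedron_subset_cube : tetrahedron ⊆ cube := fun _ hx => hx.1

theorem span_tetrahedron : Submodule.span ℝ tetrahedron = ⊤ := by
  refine span_eq_top_of_forall_single_mem fun i => ?_
  have hmem (y : R3) (h₁ : !₂[1, 1, 1] ∈ tetrahedron) (hy : y ∈ tetrahedron)
      (h : EuclideanSpace.single i 1 = (2⁻¹ : ℝ) • (!₂[1, 1, 1] + y)) :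
      EuclideanSpace.single i 1 ∈ Submodule.span ℝ tetrahedron :=
    h ▸ Submodule.smul_mem _ _
      (add_mem (Submodule.subset_span h₁) (Submodule.subset_span hy))
  have h₁ : !₂[1, 1, 1] ∈ tetrahedron := by simp [tetrahedron, Fin.forall_fin_succ]
  fin_cases i
  · refine hmem !₂[1, -1, -1] h₁ (by simp [tetrahedron, Fin.forall_fin_succ]) ?_
    ext j
    fin_cases j <;> norm_num
  · refine hmem !₂[-1, 1, -1] h₁ (by simp [tetrahedron, Fin.forall_fin_succ]) ?_
    ext j
    fin_cases j <;> norm_num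
  · refine hmem !₂[-1, -1, 1] h₁ (by simp [tetrahedron, Fin.forall_fin_succ]) ?_
    ext j
    fin_cases j <;> norm_num

theorem span_octahedron : Submodule.span ℝ octahedron = ⊤ :=
  span_eq_top_of_forall_single_mem fun i => Submodule.subset_span ⟨i, by simp⟩

theorem span_icosahedron : Submodule.span ℝ icosahedron = ⊤ := by
  refine span_eq_top_of_forall_single_mem fun i => ?_
  set e : R3 := EuclideanSpace.single i 1 with he
  set f : R3 := EuclideanSpace.single (i + 1) Real.goldenRatio with hf
  have hφ : |Real.goldenRatio| = Real.goldenRatio := abs_of_pos Real.goldenRatio_pos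
  have hadd : e + f ∈ icosahedron := ⟨i + 2, by fin_cases i <;> simp [he, hf, hφ]⟩
  have hsub : e - f ∈ icosahedron := ⟨i + 2, by fin_cases i <;> simp [he, hf, hφ]⟩
  have hsum : e = (2⁻¹ : ℝ) • ((e + f) + (e - f)) := by module
  rw [hsum]
  exact Submodule.smul_mem _ _ (add_mem (Submodule.subset_span hadd) (Submodule.subset_span hsub))

namespace IsPlatonic

variable {V : Set R3}

theorem finite (hV : IsPlatonic V) : V.Finite := by
  obtain ⟨P, hP, r, -, g, rfl⟩ := hV
  refine Set.Finite.image _ ?_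
  set C : Set ℝ := {0, 1, Real.goldenRatio, Real.goldenRatio⁻¹} with hC
  refine (finite_setOf_forall_abs_apply_mem (show C.Finite by simp [hC])).subset ?_
  have hcube : cube ⊆ {x | ∀ i, |x i| ∈ C} := fun x hx i => by simp [hC, hx i]
  rcases hP with rfl | rfl | rfl | rfl | rfl
  · exact tetrahedron_subset_cube.trans hcube
  · exact hcube
  · rintro x ⟨i, h₀, h₁, h₂⟩
    exact forall_fin_three_of_add i (by simp [hC, h₀]) (by simp [hC, h₁]) (by simp [hC, h₂])
  · rintro x ⟨i, h₀, h₁, h₂⟩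
    exact forall_fin_three_of_add i (by simp [hC, h₀]) (by simp [hC, h₁]) (by simp [hC, h₂])
  · refine union_subset hcube ?_
    rintro x ⟨i, h₀, h₁, h₂⟩
    exact forall_fin_three_of_add i (by simp [hC, h₀]) (by simp [hC, h₁]) (by simp [hC, h₂])

theorem span_eq_top (hV : IsPlatonic V) : Submodule.span ℝ V = ⊤ := by
  obtain ⟨P, hP, r, hr, g, rfl⟩ := hV
  have hspan : Submodule.span ℝ P = ⊤ := by
    have hcube : Submodule.span ℝ cube = ⊤ :=
      top_unique (span_tetrahedron ▸ Submodule.span_mono tetrahedron_subset_cube)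
    rcases hP with rfl | rfl | rfl | rfl | rfl
    · exact span_tetrahedron
    · exact hcube
    · exact span_octahedron
    · exact span_icosahedron
    · exact top_unique (hcube ▸ Submodule.span_mono subset_union_left)
  have hsurj : Function.Surjective (r • (g.toLinearEquiv : R3 →ₗ[ℝ] R3)) := fun y =>
    ⟨g.symm (r⁻¹ • y), by simp [hr.ne']⟩
  have hmap := Submodule.map_span (r • (g.toLinearEquiv : R3 →ₗ[ℝ] R3)) P
  rw [hspan, Submodule.map_top, LinearMap.range_eq_top.2 hsurj] at hmap
  exact hmap.symm

end IsPlatonic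

theorem finite_fullGroup {V : Set R3} (hV : V.Finite) (hspan : Submodule.span ℝ V = ⊤) :
    Finite (fullGroup V) := by
  have := hV.to_subtype
  let f (g : fullGroup V) (x : V) : V := ⟨g.1 x.1, g.2.subset (mem_image_of_mem _ x.2)⟩
  refine Finite.of_injective f fun g h hgh => Subtype.ext (LinearIsometryEquiv.ext fun x => ?_)
  have hlin : (g.1.toLinearEquiv : R3 →ₗ[ℝ] R3) = h.1.toLinearEquiv :=
    LinearMap.ext_on hspan fun y hy => congrArg Subtype.val (congrFun hgh ⟨y, hy⟩)
  exact LinearMap.congr_fun hlin x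

theorem rotationGroup_le_fullGroup (V : Set R3) : rotationGroup V ≤ fullGroup V :=
  fun _ hR => hR.1

theorem fullGroup_le_normalizer_rotationGroup (V : Set R3) :
    fullGroup V ≤ Subgroup.normalizer (rotationGroup V : Set (R3 ≃ₗᵢ[ℝ] R3)) := by
  intro g hg
  refine Subgroup.mem_normalizer_iff.2 fun R => and_congr ?_ (Eq.congr_left ?_)
  · rw [(fullGroup V).mul_mem_cancel_right (inv_mem hg), (fullGroup V).mul_mem_cancel_left hg]
  · exact (LinearMap.det_conj _ g.toLinearEquiv).symm

end Platonic

/-! ### Symmetric loops -/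

section Loop

variable {T S : ℝ}

theorem lintegral_Ioc_add_eq (hT : 0 < T) {f : ℝ → ℝ≥0∞} (hf : Function.Periodic f T) (a b : ℝ) :
    ∫⁻ t in Ioc a (a + T), f t = ∫⁻ t in Ioc b (b + T), f t := by
  have : VAddInvariantMeasure (AddSubgroup.zmultiples T) ℝ volume :=
    ⟨fun c s _ => measure_preimage_add _ _ _⟩
  exact (isAddFundamentalDomain_Ioc hT a).setLIntegral_eq (G := AddSubgroup.zmultiples T)
    (isAddFundamentalDomain_Ioc hT b) f hf.map_vadd_zmultiples

theorem lintegral_Ioc_comp_add_right (hT : 0 < T) {f : ℝ → ℝ≥0∞} (hf : Function.Periodic f T)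
    (S : ℝ) : ∫⁻ t in Ioc 0 T, f (t + S) = ∫⁻ t in Ioc 0 T, f t := by
  have h := (measurePreserving_add_right volume S).setLIntegral_comp_preimage_emb
    (measurableEmbedding_addRight S) f (Ioc S (S + T))
  rw [preimage_add_const_Ioc, sub_self, add_sub_cancel_left] at h
  rw [h, lintegral_Ioc_add_eq hT hf S 0, zero_add]

theorem eq_zero_of_lintegral_Ioc_eq_zero (hT : 0 < T) {f : ℝ → ℝ≥0∞} (hf : Function.Periodic f T)
    (hc : Continuous f) (h : ∫⁻ t in Ioc 0 T, f t = 0) (t : ℝ) : f t = 0 := by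
  have hzero : f =ᵐ[volume.restrict (Ioo (t - T / 2) (t - T / 2 + T))] 0 := by
    refine ae_mono (Measure.restrict_mono_set _ Ioo_subset_Ioc_self)
      ((lintegral_eq_zero_iff hc.measurable).1 ?_)
    rwa [lintegral_Ioc_add_eq hT hf _ 0, zero_add]
  refine Measure.eqOn_open_of_ae_eq hzero isOpen_Ioo hc.continuousOn continuousOn_const ?_
  constructor <;> linarith

section Closure

variable {E : Type*} [NormedAddCommGroup E] {u w : ℝ → E}

theorem enorm_norm_sub_norm_le (x y : E) : ‖‖x‖ - ‖y‖‖ₑ ≤ ‖x - y‖ₑ := by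
  rw [← ofReal_norm, ← ofReal_norm, Real.norm_eq_abs]
  exact ENNReal.ofReal_le_ofReal (abs_norm_sub_norm_le x y)

theorem enorm_norm_sub_norm_sq_le {x y x' y' : E} (h : ‖x'‖ = ‖y'‖) :
    ‖‖x‖ - ‖y‖‖ₑ ^ 2 ≤ 2 * (‖x - x'‖ₑ ^ 2 + ‖y - y'‖ₑ ^ 2) := by
  have htri : ‖‖x‖ - ‖y‖‖ₑ ≤ ‖x - x'‖ₑ + ‖y - y'‖ₑ := by
    rw [← sub_sub_sub_cancel_right ‖x‖ ‖y‖ ‖x'‖]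
    nth_rewrite 2 [h]
    exact enorm_sub_le.trans
      (add_le_add (enorm_norm_sub_norm_le x x') (enorm_norm_sub_norm_le y y'))
  have hpow := ENNReal.rpow_add_le_mul_rpow_add_rpow ‖x - x'‖ₑ ‖y - y'‖ₑ one_le_two
  simp only [ENNReal.rpow_ofNat, show (2 : ℝ) - 1 = 1 by norm_num, ENNReal.rpow_one] at hpow
  exact (pow_le_pow_left' htri 2).trans hpow

theorem lintegral_enorm_norm_sub_norm_sq_le (hT : 0 < T) (hu : Continuous u)
    (hw : Continuous w) (hup : Function.Periodic u T) (hwp : Function.Periodic w T)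
    (hwS : ∀ t, ‖w (t + S)‖ = ‖w t‖) :
    ∫⁻ t in Ioc 0 T, ‖‖u (t + S)‖ - ‖u t‖‖ₑ ^ 2 ≤ 4 * ∫⁻ t in Ioc 0 T, ‖u t - w t‖ₑ ^ 2 := by
  have hper : Function.Periodic (fun t => ‖u t - w t‖ₑ ^ 2) T := fun t => by
    simp only [hup t, hwp t]
  have hmeas : Measurable fun t => ‖u t - w t‖ₑ ^ 2 :=
    ((ENNReal.continuous_pow 2).comp (hu.sub hw).enorm).measurable
  calc ∫⁻ t in Ioc 0 T, ‖‖u (t + S)‖ - ‖u t‖‖ₑ ^ 2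
      ≤ ∫⁻ t in Ioc 0 T, 2 * (‖u (t + S) - w (t + S)‖ₑ ^ 2 + ‖u t - w t‖ₑ ^ 2) :=
        lintegral_mono fun t => enorm_norm_sub_norm_sq_le (hwS t)
    _ = 2 * ((∫⁻ t in Ioc 0 T, ‖u t - w t‖ₑ ^ 2) + ∫⁻ t in Ioc 0 T, ‖u t - w t‖ₑ ^ 2) := by
        rw [lintegral_const_mul' _ _ ENNReal.ofNat_ne_top, lintegral_add_right _ hmeas,
          lintegral_Ioc_comp_add_right hT hper S]
    _ = 4 * ∫⁻ t in Ioc 0 T, ‖u t - w t‖ₑ ^ 2 := by ring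

end Closure

theorem norm_add_eq_of_mem_h1Closure (hT : 0 < T) {K : Set (ℝ → R3)}
    (hK : ∀ w ∈ K, IsH1Loop T w ∧ ∀ t, ‖w (t + S)‖ = ‖w t‖) {u : ℝ → R3} (hu : u ∈ h1Closure T K)
    (t : ℝ) : ‖u (t + S)‖ = ‖u t‖ := by
  obtain ⟨huH, happrox⟩ := hu
  have huc : Continuous u := (huH.isACPath hT).continuous
  have hper : Function.Periodic (fun t => ‖‖u (t + S)‖ - ‖u t‖‖ₑ ^ 2) T := fun t => by
    simp only [add_right_comm t T S, huH.1 t, huH.1 (t + S)]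
  have hcont : Continuous fun t => ‖‖u (t + S)‖ - ‖u t‖‖ₑ ^ 2 :=
    (ENNReal.continuous_pow 2).comp
      ((huc.comp (continuous_id.add continuous_const)).norm.sub huc.norm).enorm
  have hzero : ∫⁻ t in Ioc 0 T, ‖‖u (t + S)‖ - ‖u t‖‖ₑ ^ 2 = 0 := by
    by_contra hne
    obtain ⟨w, hw, hd⟩ := happrox _ (ENNReal.div_pos hne ENNReal.ofNat_ne_top (b := 4))
    obtain ⟨hwH, hwS⟩ := hK w hw
    refine (lintegral_enorm_norm_sub_norm_sq_le hT huc (hwH.isACPath hT).continuous huH.1 hwH.1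
      hwS).not_gt ?_
    rw [mul_comm, ← ENNReal.lt_div_iff_mul_lt (by simp) (by simp)]
    exact (lintegral_mono fun t => le_self_add).trans_lt hd
  have hsq := eq_zero_of_lintegral_Ioc_eq_zero hT hper hcont hzero t
  rwa [pow_eq_zero_iff two_ne_zero, enorm_eq_zero, sub_eq_zero] at hsq

theorem norm_add_eq_of_mem_h1Closure_cone {G : Subgroup (R3 ≃ₗᵢ[ℝ] R3)} (hT : 0 < T) {M : ℕ}
    {c : C(AddCircle T, {x : R3 // x ∉ collisionSet G})} {u : ℝ → R3}
    (hu : u ∈ h1Closure T (cone G T M c)) (t : ℝ) : ‖u (t + T / M)‖ = ‖u t‖ := by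
  refine norm_add_eq_of_mem_h1Closure hT (fun w hw => ⟨hw.1, fun s => ?_⟩) hu t
  obtain ⟨R, -, hR⟩ := hw.2.2
  rw [hR, R.norm_map]

theorem natCast_mul_le_lintegral_Ioc {a : ℕ → ℝ} (ha : Monotone a) {f : ℝ → ℝ≥0∞} {C : ℝ≥0∞}
    (h : ∀ k, C ≤ ∫⁻ t in Ioc (a k) (a (k + 1)), f t) (n : ℕ) :
    n * C ≤ ∫⁻ t in Ioc (a 0) (a n), f t := by
  induction n with
  | zero => simp
  | succ n ih =>
    rw [← Ioc_union_Ioc_eq_Ioc (ha n.zero_le) (ha n.le_succ),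
      lintegral_union measurableSet_Ioc (Ioc_disjoint_Ioc_of_le le_rfl), Nat.cast_succ, add_mul,
      one_mul]
    exact add_le_add ih (h n)

theorem natCast_mul_ejectionAction_div {α μ : ℝ} (hα : 0 < α) {M : ℕ} (hM : M ≠ 0)
    (hT : 0 ≤ T) :
    M * ejectionAction α μ (T / M) = (2 + α) / (2 - α) * (1 / 2) * (2 * μ) ^ (2 / (2 + α)) *
      (M * Real.pi / α) ^ (2 * α / (2 + α)) * T ^ ((2 - α) / (2 + α)) := by
  have hM0 : (0 : ℝ) < M := by positivity
  have hexp : 2 * α / (2 + α) + (2 - α) / (2 + α) = 1 := by field_simp; ring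
  have hsplit : (M : ℝ) = M ^ (2 * α / (2 + α)) * M ^ ((2 - α) / (2 + α)) := by
    rw [← Real.rpow_add hM0, hexp, Real.rpow_one]
  rw [ejectionAction, Real.div_rpow hT hM0.le, mul_div_assoc (M : ℝ),
    Real.mul_rpow hM0.le (by positivity)]
  nth_rewrite 1 [hsplit]
  field_simp

theorem IsACPath.natCast_mul_ejectionAction_le_lintegral {E : Type*} [NormedAddCommGroup E]
    [NormedSpace ℝ E] [CompleteSpace E] {u : ℝ → E} (hu : IsACPath u) {α μ : ℝ} (hα : 1 ≤ α)
    (hα2 : α < 2) (hμ : 0 < μ) (hT : 0 < T) (hper : Function.Periodic u T) {M : ℕ} (hM : M ≠ 0)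
    (hnorm : ∀ t, ‖u (t + T / M)‖ = ‖u t‖) {t₀ : ℝ} (h₀ : u t₀ = 0) :
    M * ENNReal.ofReal (ejectionAction α μ (T / M)) ≤
      ∫⁻ t in Ioc 0 T, (‖deriv u t‖ₑ ^ 2 / 2 + ENNReal.ofReal μ / ‖u t‖ₑ ^ α) := by
  have hS : 0 < T / M := by positivity
  set a : ℕ → ℝ := fun k => t₀ + k * (T / M) with ha
  have hzero (k : ℕ) : u (a k) = 0 :=
    norm_eq_zero.1 ((Function.Periodic.nat_mul (f := fun t => ‖u t‖) hnorm k t₀).trans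
      (norm_eq_zero.2 h₀))
  have ha₀ : a 0 = t₀ := by simp only [ha, Nat.cast_zero, zero_mul, add_zero]
  have haM : a M = t₀ + T := by
    simp only [ha, mul_div_cancel₀ T (Nat.cast_ne_zero (R := ℝ).2 hM)]
  have hlen (k : ℕ) : a (k + 1) - a k = T / M := by simp only [ha]; push_cast; ring
  have hlt (k : ℕ) : a k < a (k + 1) := sub_pos.1 (hS.trans_eq (hlen k).symm)
  have harcs := natCast_mul_le_lintegral_Ioc (monotone_nat_of_le_succ fun k => (hlt k).le)
    (fun k => hlen k ▸ hu.ejectionAction_le_lintegral hα hα2 hμ (hlt k) (hzero k) (hzero (k + 1))) M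
  have hLper : Function.Periodic
      (fun t => ‖deriv u t‖ₑ ^ 2 / 2 + ENNReal.ofReal μ / ‖u t‖ₑ ^ α) T := fun t => by
    simp only [periodic_deriv hper t, hper t]
  rwa [ha₀, haM, lintegral_Ioc_add_eq hT hLper t₀ 0, zero_add] at harcs

end Loop

section Action

variable {G H : Subgroup (R3 ≃ₗᵢ[ℝ] R3)} [Finite G] [Finite H] {τ : Set R3} {α m₀ : ℝ}

theorem lintegral_le_action (hG : ∀ R ∈ G, LinearMap.det (R.toLinearEquiv : R3 →ₗ[ℝ] R3) = 1)
    (hH : H ≤ Subgroup.normalizer (G : Set (R3 ≃ₗᵢ[ℝ] R3))) (hτ : τ ∈ tessellation H)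
    (hα : 0 < α) (hm₀ : 0 ≤ m₀) (T : ℝ) (u : ℝ → R3) :
    Nat.card G * ∫⁻ t in Ioc 0 T, (‖deriv u t‖ₑ ^ 2 / 2 +
      ENNReal.ofReal (m₀ + potentialBound G τ α / 2) / ‖u t‖ₑ ^ α) ≤ action G α m₀ T u := by
  have hB := potentialBound_nonneg (G := G) (α := α) τ
  refine mul_le_mul_right (lintegral_mono fun t => ?_) _
  rw [ENNReal.ofReal_add hm₀ (by positivity), ENNReal.add_div, ← add_assoc,
    div_eq_inv_mul (potentialBound G τ α), ENNReal.ofReal_mul (by positivity), mul_div_assoc]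
  refine add_le_add_right (mul_le_mul' ?_ (ofReal_potentialBound_div_le hG hH hτ hα (u t))) _
  rw [ENNReal.ofReal_inv_of_pos two_pos, ENNReal.ofReal_ofNat, one_div]

end Action

end PlatonicBody

open PlatonicBody in
theorem mainTheorem9_general {G H : Subgroup (R3 ≃ₗᵢ[ℝ] R3)} [Finite G] [Finite H]
    (hG : ∀ R ∈ G, LinearMap.det (R.toLinearEquiv : R3 →ₗ[ℝ] R3) = 1)
    (hH : H ≤ Subgroup.normalizer (G : Set (R3 ≃ₗᵢ[ℝ] R3))) {τ : Set R3} (hτ : τ ∈ tessellation H)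
    {α m₀ T : ℝ} (hα : 1 ≤ α) (hα2 : α < 2) (hm₀ : 0 ≤ m₀) (hT : 0 < T) {M : ℕ} (hM : M ≠ 0)
    {u : ℝ → R3} (hu : IsH1Loop T u) (hnorm : ∀ t, ‖u (t + T / M)‖ = ‖u t‖)
    (hcoll : ∃ t, u t = 0) :
    ENNReal.ofReal ((2 + α) / (2 - α) * ((Nat.card G : ℝ) / 2)
        * (potentialBound G τ α + 2 * m₀) ^ (2 / (2 + α)) * (M * Real.pi / α) ^ (2 * α / (2 + α))
        * T ^ ((2 - α) / (2 + α))) ≤ action G α m₀ T u := by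
  obtain ⟨t₀, h₀⟩ := hcoll
  have hB : 0 ≤ potentialBound G τ α := potentialBound_nonneg τ
  obtain ⟨μ, hμdef⟩ : ∃ μ, μ = m₀ + potentialBound G τ α / 2 := ⟨_, rfl⟩
  have h2μ : potentialBound G τ α + 2 * m₀ = 2 * μ := by rw [hμdef]; ring
  have hμ0 : 0 ≤ μ := by rw [hμdef]; positivity
  rw [h2μ]
  rcases hμ0.eq_or_lt with rfl | hμ
  · rw [mul_zero, Real.zero_rpow (by positivity)]
    simp
  have hval := natCast_mul_ejectionAction_div (μ := μ) (one_pos.trans_le hα) hM hT.le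
  have harcs := (hu.isACPath hT).natCast_mul_ejectionAction_le_lintegral hα hα2 hμ hT hu.1 hM
    hnorm h₀
  have haction := lintegral_le_action hG hH hτ (one_pos.trans_le hα) hm₀ T u
  rw [← hμdef] at haction
  calc _ = ENNReal.ofReal (Nat.card G * (M * ejectionAction α μ (T / M))) := by
        rw [hval]; congr 1; ring
    _ = Nat.card G * (M * ENNReal.ofReal (ejectionAction α μ (T / M))) := by
        simp only [ENNReal.ofReal_mul, Nat.cast_nonneg, ENNReal.ofReal_natCast]
    _ ≤ _ := (mul_le_mul_right harcs _).trans haction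

theorem mainTheorem9 (V : Set PlatonicBody.R3) (hV : PlatonicBody.IsPlatonic V)
    (α : ℝ) (hα : 1 ≤ α ∧ α < 2) (m₀ : ℝ) (hm₀ : 0 ≤ m₀) (T : ℝ) (hT : 0 < T)
    (M : ℕ) (hM : 1 ≤ M)
    (c : C(AddCircle T,
      {x : PlatonicBody.R3 // x ∉ PlatonicBody.collisionSet (PlatonicBody.rotationGroup V)}))
    (hc : ¬ c.Nullhomotopic)
    (τ : Set PlatonicBody.R3)
    (hτ : τ ∈ PlatonicBody.tessellation (PlatonicBody.fullGroup V))
    (u : ℝ → PlatonicBody.R3)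
    (hu : u ∈ PlatonicBody.h1Closure T
      (PlatonicBody.cone (PlatonicBody.rotationGroup V) T M c))
    (hcoll : (M : ℕ∞) ≤ (PlatonicBody.totalCollisions T u).encard) :
    ENNReal.ofReal
      ((2 + α) / (2 - α) * ((Nat.card (PlatonicBody.rotationGroup V) : ℝ) / 2)
        * (PlatonicBody.potentialBound (PlatonicBody.rotationGroup V) τ α + 2 * m₀)
            ^ (2 / (2 + α))
        * (M * Real.pi / α) ^ (2 * α / (2 + α))
        * T ^ ((2 - α) / (2 + α)))
      ≤ PlatonicBody.action (PlatonicBody.rotationGroup V) α m₀ T u := by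
  have := PlatonicBody.finite_fullGroup hV.finite hV.span_eq_top
  have := Finite.of_injective _ (Subgroup.inclusion_injective
    (PlatonicBody.rotationGroup_le_fullGroup V))
  obtain ⟨t, ht⟩ := encard_pos.1 ((Nat.cast_pos.2 hM).trans_le hcoll)
  exact mainTheorem9_general (fun _ (hR : _ ∈ PlatonicBody.rotationGroup V) => hR.2)
    (PlatonicBody.fullGroup_le_normalizer_rotationGroup V) hτ hα.1 hα.2 hm₀ hT
    (Nat.one_le_iff_ne_zero.1 hM) hu.1 (PlatonicBody.norm_add_eq_of_mem_h1Closure_cone hT hu)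
    ⟨t, ht.2⟩
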